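/- Let $G=(V,E)$ be a finite simple undirected graph with $n=|V|$ vertices and $m=|E|$ edges. An orientation of $G$ gives each edge one of its two directions; a vertex is a sink of it if all edges at that vertex point to it, and an orientation is sink-free if it has no sink. Sink-popping on $G$ is the following procedure. Orient each edge independently and uniformly at random; while the current orientation has at least one sink, re-orient all edges that are incident to sinks, independently and uniformly at random; when there is no sink, return the current orientation. The number of random variables drawn is $m$ (for the initial orientation) plus the sum, over all rounds of the loop, of the number of edges re-oriented in that round. If $G$ is connected and not a tree, then sink-popping on $G$ halts almost surely, the orientation that it returns is uniformly distributed on the set of sink-free orientations of $G$, and the expected number of random variables drawn is at most $m+n(n-1)$. For every $n\ge 3$, this bound is attained on the cycle with $n$ vertices: there the expected number of random variables drawn is exactly $m+n(n-1)$ with $m=n$, that is, $n^2$. -/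

import Mathlib

open MeasureTheory ProbabilityTheory
open scoped ENNReal

namespace SinkPopping

variable {V : Type*} (G : SimpleGraph V)

/-- The two possible orientations of the edge `e`, encoded by the endpoint of `e` that the edge
points to (its head). -/
def Head (e : G.edgeSet) : Type _ := {v : V // v ∈ (e : Sym2 V)}

instance (e : G.edgeSet) : MeasurableSpace (Head G e) := ⊤

instance (e : G.edgeSet) : MeasurableSingletonClass (Head G e) := ⟨fun _ => trivial⟩

instance (e : G.edgeSet) : Nonempty (Head G e) :=
  ⟨⟨(Quot.out (e : Sym2 V)).1, Sym2.out_fst_mem _⟩⟩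

instance [Finite V] (e : G.edgeSet) : Finite (Head G e) :=
  inferInstanceAs (Finite {v : V // v ∈ (e : Sym2 V)})

/-- An orientation of `G`: every edge chooses its head. -/
abbrev Orientation : Type _ := (e : G.edgeSet) → Head G e

variable {G}

/-- `v` is a sink of `σ`: every edge incident to `v` points to `v`. -/
def IsSink (σ : Orientation G) (v : V) : Prop :=
  ∀ e : G.edgeSet, v ∈ (e : Sym2 V) → (σ e).1 = v

/-- `σ` has no sink. -/
def IsSinkFree (σ : Orientation G) : Prop := ∀ v : V, ¬ IsSink σ v

/-- The edges that are incident to at least one sink of `σ`. -/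
def sinkEdges (σ : Orientation G) : Set G.edgeSet :=
  {e | ∃ v ∈ (e : Sym2 V), IsSink σ v}

variable (G)

/-- The randomness available to the algorithm: the entry `(t, e)` is the orientation that is
drawn for the edge `e` in round `t`, should the algorithm draw one. -/
abbrev Draws : Type _ := (p : ℕ × G.edgeSet) → Head G p.2

/-- All draws are independent, and each is uniform on the two orientations of its edge. -/
noncomputable def drawLaw [Finite V] : Measure (Draws G) :=
  Measure.infinitePi fun p : ℕ × G.edgeSet => uniformOn (Set.univ : Set (Head G p.2))

variable {G}

open Classical in
/-- The current orientation of sink-popping after `t` rounds of the loop. Round `0` orients every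
edge; each later round re-orients exactly the edges incident to sinks. Once the orientation is
sink-free (the loop has ended) nothing changes any more. -/
noncomputable def run (ω : Draws G) : ℕ → Orientation G
  | 0 => fun e => ω (0, e)
  | t + 1 => fun e => if e ∈ sinkEdges (run ω t) then ω (t + 1, e) else run ω t e

/-- The loop ends. -/
def Halts (ω : Draws G) : Prop := ∃ t, IsSinkFree (run ω t)

/-- The orientation returned: the state at the first time at which it is sink-free.
(Only meaningful if the loop ends.) -/
noncomputable def output (ω : Draws G) : Orientation G :=
  run ω (sInf {t | IsSinkFree (run ω t)})

/-- The total number of random variables drawn: one for each edge in the initial round, and one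
for each re-oriented edge in each later round (rounds after the end of the loop contribute `0`). -/
noncomputable def numDrawn (ω : Draws G) : ℝ≥0∞ :=
  (Nat.card G.edgeSet : ℝ≥0∞) + ∑' t : ℕ, ((sinkEdges (run ω t)).ncard : ℝ≥0∞)

variable (G)

/-- The expected number of random variables drawn by sink-popping on `G`. -/
noncomputable def expectedDrawn [Finite V] : ℝ≥0∞ := ∫⁻ ω, numDrawn ω ∂(drawLaw G)

end SinkPopping

/-! The proof joins an exact formula for the expected cost to a combinatorial inequality. Write `n`
for the number of vertices and `F` for the number of sink-free orientations.

Formula. The probability of being in a given orientation after `t` rounds depends only on its set of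
sinks (`drawLaw_run`), which gives the recursion `mass`. For a fixed vertex `v`, sum the mass of
`sinks σ` without `v` over all `σ` in which `v` is a sink. This sum grows from round to round by
exactly the probability that `v` is a sink (`cumMass_succ`), and it is bounded, because the mass of
`∅` is at most `1 / F`. So these probabilities are summable, the mass of every nonempty set tends to
`0`, and that of `∅` tends to `1 / F`. Halting and uniformity follow, and `v` is a sink after an
expected `#{σ | OnlySink σ v} / F` rounds. Weighting by degrees gives `expectedDrawn_eq`.

Inequality. The degrees of the sinks, summed over all pairs in `soleSinks G`, must not exceed `n (n
- 1) F`. In such a pair the basin `W` of the sink spans a tree, which can be rerooted at each of its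
vertices (`exists_reroot`), so pairs group into families indexed by the vertices of `W`. The degree
sum of a family is at most `2 (|W| - 1) + d`, where `d` is the number of edges leaving `W`; this is
charged to those `d` edges (`sum_degree_soleSinks_le`). Turning the sink's edge outward along one of
them produces a sink-free orientation, from which the exit is recovered once `v` is known. Each
sink-free orientation is charged at most `n (n - 1)` in total (`sum_exitWeight_le`).

On a cycle there are at most two sink-free orientations and at least `n (n - 1)` with one sink, each
sink of degree two, which forces equality. -/

namespace SinkPopping

open scoped Classical

/-! ### Arcs, basins and rerooting -/

section Arcs

variable {V : Type*} {G : SimpleGraph V} {σ τ : Orientation G} {a b c u v x y : V}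

/-- The edge between `a` and `b` is present and points to `b`. -/
def Arc (σ : Orientation G) (a b : V) : Prop :=
  ∃ e : G.edgeSet, (e : Sym2 V) = s(a, b) ∧ (σ e).1 = b

theorem Arc.adj (h : Arc σ a b) : G.Adj a b := by
  obtain ⟨e, he, -⟩ := h
  have := e.2
  rwa [he] at this

theorem arc_or_arc (h : G.Adj a b) : Arc σ a b ∨ Arc σ b a := by
  have hm := (σ ⟨s(a, b), h⟩).2
  rcases Sym2.mem_iff.1 hm with h1 | h1
  · exact Or.inr ⟨⟨s(a, b), h⟩, Sym2.eq_swap, h1⟩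
  · exact Or.inl ⟨⟨s(a, b), h⟩, rfl, h1⟩

theorem Arc.asymm (h : Arc σ a b) : ¬ Arc σ b a := by
  rintro ⟨e', he', h'⟩
  have hne := h.adj.ne
  obtain ⟨e, he, h⟩ := h
  have : e = e' := Subtype.ext (by rw [he, he', Sym2.eq_swap])
  subst this
  exact hne (h'.symm.trans h)

theorem isSink_iff_forall_not_arc : IsSink σ v ↔ ∀ u, ¬ Arc σ v u := by
  constructor
  · rintro h u ⟨e, he, hu⟩
    have h1 := h e (by rw [he]; exact Sym2.mem_mk_left _ _)
    have h2 := e.2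
    rw [he, ← hu, h1] at h2
    exact G.loopless.irrefl _ h2
  · intro h e hv
    by_contra hne
    obtain ⟨u, hu⟩ := Sym2.mem_iff_exists.1 hv
    have hm : (σ e).1 ∈ s(v, u) := hu ▸ (σ e).2
    rcases Sym2.mem_iff.1 hm with h1 | h1
    · exact hne h1
    · exact h u ⟨e, hu, h1⟩

theorem IsSink.arc_of_adj (h : IsSink σ v) (hu : G.Adj v x) : Arc σ x v :=
  (arc_or_arc hu).resolve_left (isSink_iff_forall_not_arc.1 h x)

theorem IsSink.not_adj (hx : IsSink σ x) (hy : IsSink σ y) : ¬ G.Adj x y := fun h =>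
  isSink_iff_forall_not_arc.1 hy _ (hx.arc_of_adj h)

theorem isSinkFree_iff : IsSinkFree σ ↔ ∀ v, ∃ u, Arc σ v u := by
  simp [IsSinkFree, isSink_iff_forall_not_arc]

theorem orientation_ext (h : ∀ a b, Arc σ a b → Arc τ a b) : σ = τ := by
  funext e
  obtain ⟨a, ha⟩ := Sym2.mem_iff_exists.1 (σ e).2
  obtain ⟨e', he', h'⟩ := h a (σ e).1 ⟨e, ha.trans Sym2.eq_swap, rfl⟩
  have : e = e' := Subtype.ext (ha.trans (Sym2.eq_swap.trans he'.symm))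
  subst this
  exact Subtype.ext h'.symm

/-- The orientation `σ` with the edge between `a` and `b` redirected to `b`. -/
noncomputable def point (σ : Orientation G) (a b : V) (h : G.Adj a b) : Orientation G :=
  Function.update σ ⟨s(a, b), G.mem_edgeSet.2 h⟩ ⟨b, Sym2.mem_mk_right a b⟩

theorem point_self (h : G.Adj a b) : (point σ a b h ⟨s(a, b), G.mem_edgeSet.2 h⟩).1 = b := by
  have : point σ a b h ⟨s(a, b), G.mem_edgeSet.2 h⟩ = ⟨b, Sym2.mem_mk_right a b⟩ :=
    Function.update_self _ _ _
  rw [this]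

theorem point_of_ne (h : G.Adj a b) {e : G.edgeSet} (he : (e : Sym2 V) ≠ s(a, b)) :
    point σ a b h e = σ e :=
  Function.update_of_ne (fun h' => he (congrArg Subtype.val h')) _ _

theorem arc_point (h : G.Adj a b) :
    Arc (point σ a b h) x y ↔ (x = a ∧ y = b) ∨ (Arc σ x y ∧ ¬ (x = b ∧ y = a)) := by
  constructor
  · intro hxy
    have hne := hxy.adj.ne
    obtain ⟨e, he, hy⟩ := hxy
    by_cases hee : (e : Sym2 V) = s(a, b)
    · obtain rfl : e = ⟨s(a, b), G.mem_edgeSet.2 h⟩ := Subtype.ext hee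
      rw [point_self] at hy
      subst hy
      rcases Sym2.eq_iff.1 he with h1 | h1
      · exact Or.inl ⟨h1.1.symm, rfl⟩
      · exact absurd h1.2.symm hne
    · rw [point_of_ne h hee] at hy
      refine Or.inr ⟨⟨e, he, hy⟩, ?_⟩
      rintro ⟨rfl, rfl⟩
      exact hee (he.trans Sym2.eq_swap)
  · rintro (⟨rfl, rfl⟩ | ⟨⟨e, he, hy⟩, hn⟩)
    · exact ⟨_, rfl, point_self h⟩
    · by_cases hee : (e : Sym2 V) = s(a, b)
      · obtain rfl : e = ⟨s(a, b), G.mem_edgeSet.2 h⟩ := Subtype.ext hee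
        rcases Sym2.eq_iff.1 he with h1 | h1
        · exact ⟨_, he, (point_self h).trans h1.2⟩
        · exact absurd ⟨h1.2.symm, h1.1.symm⟩ hn
      · exact ⟨e, he, by rw [point_of_ne h hee]; exact hy⟩

/-- The only arc leaving `x` goes to `y`. -/
def Single (σ : Orientation G) (x y : V) : Prop :=
  Arc σ x y ∧ ∀ z, Arc σ x z → z = y

/-- `v` is the only sink of `σ`. -/
def OnlySink (σ : Orientation G) (v : V) : Prop :=
  IsSink σ v ∧ ∀ w, IsSink σ w → w = v

theorem Single.right_unique {z : V} (h : Single σ x y) (h' : Single σ x z) : y = z :=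
  h'.2 _ h.1

theorem OnlySink.exists_arc (h : OnlySink σ v) (hx : x ≠ v) : ∃ y, Arc σ x y := by
  by_contra! hn
  exact hx (h.2 x (isSink_iff_forall_not_arc.2 hn))

/-- `z` lies in the basin of `v` if the forced walk from `z` along vertices of out-degree one
arrives at `v`. -/
def InBasin (σ : Orientation G) (v z : V) : Prop := Relation.ReflTransGen (Single σ) z v

theorem InBasin.refl : InBasin σ v v := Relation.ReflTransGen.refl

theorem InBasin.head (h : Single σ x y) (hy : InBasin σ v y) : InBasin σ v x :=
  Relation.ReflTransGen.head h hy

theorem InBasin.exists_single (h : InBasin σ v x) (hx : x ≠ v) :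
    ∃ y, Single σ x y ∧ InBasin σ v y := by
  rcases Relation.ReflTransGen.cases_head h with h | h
  · exact absurd h hx
  · exact h

theorem InBasin.of_arc (h : InBasin σ v x) (hx : x ≠ v) (hxy : Arc σ x y) :
    Single σ x y ∧ InBasin σ v y := by
  obtain ⟨z, hz, hb⟩ := h.exists_single hx
  obtain rfl := hz.2 y hxy
  exact ⟨hz, hb⟩

theorem InBasin.mono (hστ : ∀ z y, z ≠ v → InBasin σ v y → Single σ z y → InBasin τ v y →
    InBasin τ v z) (h : InBasin σ v x) : InBasin τ v x := by
  induction h using Relation.ReflTransGen.head_induction_on with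
  | refl => exact .refl
  | head h1 h2 ih =>
    rename_i z y
    by_cases hz : z = v
    · subst hz; exact .refl
    · exact hστ z y hz h2 h1 ih

/-- The reversal takes from `x` its only outgoing arc and gives one to `v`; every other vertex keeps
the arcs that leave it. -/
theorem OnlySink.reroot (hv : OnlySink σ v) (hx : Single σ x v) :
    OnlySink (point σ v x hx.1.adj.symm) x := by
  constructor
  · rw [isSink_iff_forall_not_arc]
    intro u hu
    rw [arc_point] at hu
    rcases hu with ⟨h, -⟩ | ⟨h, h'⟩
    · exact hx.1.adj.ne h
    · exact h' ⟨rfl, hx.2 u h⟩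
  · intro w hw
    by_contra hne
    rw [isSink_iff_forall_not_arc] at hw
    by_cases hwv : w = v
    · exact hw x (by rw [arc_point]; exact Or.inl ⟨hwv, rfl⟩)
    · obtain ⟨y, hy⟩ := hv.exists_arc hwv
      exact hw y (by rw [arc_point]; exact Or.inr ⟨hy, fun h => hne h.1⟩)

theorem InBasin.reroot (hv : OnlySink σ v) (hx : Single σ x v) {z : V} (hz : InBasin σ v z) :
    InBasin (point σ v x hx.1.adj.symm) x z := by
  induction hz using Relation.ReflTransGen.head_induction_on with
  | refl =>
    refine InBasin.head ⟨arc_point _ |>.2 (Or.inl ⟨rfl, rfl⟩), fun z hz => ?_⟩ .refl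
    rcases (arc_point _).1 hz with h | h
    · exact h.2
    · exact absurd h.1 (isSink_iff_forall_not_arc.1 hv.1 _)
  | head h1 h2 ih =>
    rename_i z y
    by_cases hzx : z = x
    · subst hzx; exact .refl
    · refine InBasin.head ⟨arc_point _ |>.2 (Or.inr ⟨h1.1, fun h => hzx h.1⟩), fun u hu => ?_⟩ ih
      rcases (arc_point _).1 hu with h | h
      · obtain ⟨rfl, -⟩ := h
        exact absurd h1.1 (isSink_iff_forall_not_arc.1 hv.1 _)
      · exact h1.2 u h.1

theorem point_point (hx : Arc σ x v) :
    point (point σ v x hx.adj.symm) x v hx.adj = σ := by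
  refine orientation_ext fun a b hab => ?_
  rw [arc_point, arc_point] at hab
  rcases hab with ⟨rfl, rfl⟩ | ⟨⟨rfl, rfl⟩ | h, h'⟩
  · exact hx
  · exact absurd ⟨rfl, rfl⟩ h'
  · exact h.1

theorem single_point (hv : IsSink σ v) (h : G.Adj v u) : Single (point σ v u h) v u := by
  refine ⟨(arc_point h).2 (Or.inl ⟨rfl, rfl⟩), fun z hz => ?_⟩
  rcases (arc_point h).1 hz with h' | h'
  · exact h'.2
  · exact absurd h'.1 (isSink_iff_forall_not_arc.1 hv _)

theorem single_reroot (hv : OnlySink σ v) (hx : Single σ x v) :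
    Single (point σ v x hx.1.adj.symm) v x :=
  single_point hv.1 _

/-- Reversing the same edge again restores `σ`, so the inclusion `InBasin.reroot` applies in both
directions. -/
theorem inBasin_reroot_iff (hv : OnlySink σ v) (hx : Single σ x v) {z : V} :
    InBasin (point σ v x hx.1.adj.symm) x z ↔ InBasin σ v z := by
  refine ⟨fun h => ?_, InBasin.reroot hv hx⟩
  have := h.reroot (hv.reroot hx) (single_reroot hv hx)
  rwa [point_point hx.1] at this

/-- Every vertex of the basin of the only sink can be made the only sink without changing the
basin, or any arc that does not lie inside it. -/
theorem exists_reroot (hv : OnlySink σ v) (hx : InBasin σ v x) :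
    ∃ σ' : Orientation G, OnlySink σ' x ∧ (∀ z, InBasin σ' x z ↔ InBasin σ v z) ∧
      ∀ a b, ¬ (InBasin σ v a ∧ InBasin σ v b) → (Arc σ' a b ↔ Arc σ a b) := by
  induction hx using Relation.ReflTransGen.head_induction_on with
  | refl => exact ⟨σ, hv, fun _ => Iff.rfl, fun _ _ _ => Iff.rfl⟩
  | head h1 h2 ih =>
    rename_i z y
    obtain ⟨σ', hs, hb, ha⟩ := ih
    have hzy : z ≠ y := h1.1.adj.ne
    have hz : InBasin σ v z := InBasin.head h1 h2
    -- The basin is unchanged, so `z` still has a single outgoing arc; the sink `y` receives the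
    -- edge from `z`, so this arc is the one to `y`.
    have hs1 : Single σ' z y :=
      (((hb z).2 hz).of_arc hzy (hs.1.arc_of_adj h1.1.adj.symm))|>.1
    refine ⟨point σ' y z hs1.1.adj.symm, hs.reroot hs1, fun w => ?_, fun a b hab => ?_⟩
    · rw [inBasin_reroot_iff hs hs1, hb]
    · rw [arc_point, ← ha a b hab]
      constructor
      · rintro (⟨rfl, rfl⟩ | h)
        · exact absurd ⟨h2, hz⟩ hab
        · exact h.1
      · intro h
        refine Or.inr ⟨h, ?_⟩
        rintro ⟨rfl, rfl⟩
        exact hab ⟨hz, h2⟩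

/-- Inside the basin everything is forced from the sink backwards: all edges at `v` point to it, and
once the arc leaving a basin vertex is known, all its other edges must point to it. -/
theorem eq_of_onlySink (hσ : OnlySink σ v) (hτ : OnlySink τ v)
    (hb : ∀ z, InBasin σ v z ↔ InBasin τ v z)
    (ha : ∀ a b, ¬ (InBasin σ v a ∧ InBasin σ v b) → (Arc σ a b → Arc τ a b)) : σ = τ := by
  have key : ∀ z, InBasin σ v z → ∀ u, Arc σ u z → Arc τ u z := by
    intro z hz
    induction hz using Relation.ReflTransGen.head_induction_on with
    | refl => exact fun u hu => hτ.1.arc_of_adj hu.adj.symm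
    | head h1 h2 ih =>
      rename_i z y
      have hz : InBasin σ v z := InBasin.head h1 h2
      intro u hu
      have hzv : z ≠ v := by
        rintro rfl
        exact isSink_iff_forall_not_arc.1 hσ.1 _ h1.1
      have hs := ((hb z).1 hz).of_arc hzv (ih z h1.1)
      by_contra hn
      have := hs.1.2 u ((arc_or_arc hu.adj).resolve_left hn)
      subst this
      exact hu.asymm h1.1
  refine orientation_ext fun a b hab => ?_
  by_cases h : InBasin σ v a ∧ InBasin σ v b
  · exact key b h.2 a hab
  · exact ha a b h hab

end Arcs

end SinkPopping

namespace SinkPopping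

open scoped Classical
open Finset

/-! ### Degree sums over basins -/

noncomputable section Counting

variable {V : Type*} [Fintype V] {G : SimpleGraph V} {σ τ : Orientation G} {a b c v x y : V}

instance (e : G.edgeSet) : Fintype (Head G e) := Fintype.ofFinite _

/-- The basin of `v` as a finset. -/
def basin (σ : Orientation G) (v : V) : Finset V := univ.filter (InBasin σ v)

@[simp] theorem mem_basin : x ∈ basin σ v ↔ InBasin σ v x := by simp [basin]

/-- The edges leaving `W`, as pairs of an endpoint in `W` and one outside. -/
def boundary (G : SimpleGraph V) (W : Finset V) : Finset (V × V) :=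
  univ.filter fun p => p.1 ∈ W ∧ p.2 ∉ W ∧ G.Adj p.1 p.2

@[simp] theorem mem_boundary {W : Finset V} {p : V × V} :
    p ∈ boundary G W ↔ p.1 ∈ W ∧ p.2 ∉ W ∧ G.Adj p.1 p.2 := by simp [boundary]

/-- The orientations with exactly one sink, together with that sink. -/
def soleSinks (G : SimpleGraph V) : Finset (Orientation G × V) :=
  univ.filter fun p => OnlySink p.1 p.2

@[simp] theorem mem_soleSinks {p : Orientation G × V} :
    p ∈ soleSinks G ↔ OnlySink p.1 p.2 := by simp [soleSinks]

/-- The sink-free orientations. -/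
def sinkFree (G : SimpleGraph V) : Finset (Orientation G) := univ.filter IsSinkFree

@[simp] theorem mem_sinkFree : σ ∈ sinkFree G ↔ IsSinkFree σ := by simp [sinkFree]

/-- The number of edges that leave `W` at `w`. -/
def outer (G : SimpleGraph V) (W : Finset V) (w : V) : ℕ := #{u | u ∉ W ∧ G.Adj w u}

theorem sum_outer (W : Finset V) : ∑ w ∈ W, outer G W w = #(boundary G W) := by
  have : boundary G W = (W.sigma fun w => {u | u ∉ W ∧ G.Adj w u} : Finset (Σ _ : V, V)).map
      (Equiv.sigmaEquivProd V V).toEmbedding := by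
    ext ⟨a, b⟩
    simp
  rw [this, card_map, card_sigma]
  rfl

theorem degree_eq_card (w : V) : G.degree w = #{u | G.Adj w u} := by
  rw [← G.card_neighborFinset_eq_degree, SimpleGraph.neighborFinset_eq_filter]

/-- An arc inside the basin is determined by its tail, and the tail is never `v`. -/
theorem card_arcs_inside_le (hv : OnlySink σ v) :
    #{p : V × V | p.1 ∈ basin σ v ∧ p.2 ∈ basin σ v ∧ Arc σ p.1 p.2} ≤ #(basin σ v) - 1 := by
  rw [← card_erase_of_mem (a := v) (by simp [InBasin.refl])]
  have hne : ∀ p : V × V, Arc σ p.1 p.2 → p.1 ≠ v := by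
    rintro p hp rfl
    exact isSink_iff_forall_not_arc.1 hv.1 _ hp
  refine card_le_card_of_injOn Prod.fst ?_ ?_
  · intro p hp
    simp only [mem_basin, coe_filter, mem_univ, true_and, Set.mem_ofPred_eq] at hp
    simp [hne p hp.2.2, hp.1]
  · intro p hp q hq hpq
    simp only [mem_basin, coe_filter, mem_univ, true_and, Set.mem_ofPred_eq] at hp hq
    have h1 := (hp.1.of_arc (hne p hp.2.2) hp.2.2).1
    refine Prod.ext hpq ?_
    exact (h1.2 q.2 (hpq ▸ hq.2.2)).symm

/-- The degree sum counts inner edges twice and boundary edges once. -/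
theorem sum_degree_basin_le (hv : OnlySink σ v) :
    ∑ w ∈ basin σ v, G.degree w ≤ 2 * (#(basin σ v) - 1) + #(boundary G (basin σ v)) := by
  set W := basin σ v with hW
  set A : Finset (V × V) := {p : V × V | p.1 ∈ W ∧ p.2 ∈ W ∧ Arc σ p.1 p.2} with hA
  have hAc : #A ≤ #W - 1 := card_arcs_inside_le hv
  have h1 : ∑ w ∈ W, G.degree w = #{p : V × V | p.1 ∈ W ∧ G.Adj p.1 p.2} := by
    have : ({p : V × V | p.1 ∈ W ∧ G.Adj p.1 p.2} : Finset (V × V)) =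
        (W.sigma fun w => {u | G.Adj w u} : Finset (Σ _ : V, V)).map (Equiv.sigmaEquivProd V V).toEmbedding := by
      ext ⟨a, b⟩
      simp
    rw [this, card_map, card_sigma]
    exact sum_congr rfl fun w _ => degree_eq_card w
  have h2 : ({p : V × V | p.1 ∈ W ∧ G.Adj p.1 p.2} : Finset (V × V)) ⊆
      A ∪ A.map (Equiv.prodComm V V).toEmbedding ∪ boundary G W := by
    rintro ⟨a, b⟩ h
    simp only [mem_filter, mem_univ, true_and] at h
    by_cases hb : b ∈ W
    · rcases arc_or_arc (σ := σ) h.2 with h' | h'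
      · simp [hA, h.1, hb, h']
      · simp [hA, h.1, hb, h']
    · simp [h.1, hb, h.2]
  calc _ = _ := h1
    _ ≤ _ := card_le_card h2
    _ ≤ #A + #A + #(boundary G W) := by
      refine (card_union_le _ _).trans (Nat.add_le_add_right ((card_union_le _ _).trans ?_) _)
      rw [card_map]
    _ ≤ _ := by omega

/-- Orientations with a unique sink share this key if they differ only inside a common basin. -/
def basinKey (p : Orientation G × V) : Finset V × (V → V → Prop) :=
  (basin p.1 p.2, fun a b => ¬ (a ∈ basin p.1 p.2 ∧ b ∈ basin p.1 p.2) ∧ Arc p.1 a b)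

/-- Every basin vertex is the sink of exactly one member of the family: `exists_reroot` gives one,
`eq_of_onlySink` excludes a second. -/
theorem sum_fiber_basinKey {p : Orientation G × V} (hp : OnlySink p.1 p.2) (f : V → ℕ) :
    ∑ q ∈ soleSinks G with basinKey q = basinKey p, f q.2 = ∑ w ∈ basin p.1 p.2, f w := by
  have hkey : ∀ q r : Orientation G × V, basinKey q = basinKey r →
      basin q.1 q.2 = basin r.1 r.2 ∧ ∀ a b, ¬ (a ∈ basin r.1 r.2 ∧ b ∈ basin r.1 r.2) →
        (Arc q.1 a b ↔ Arc r.1 a b) := by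
    intro q r h
    have h1 := congrArg Prod.fst h
    have h2 := congrArg Prod.snd h
    simp only [basinKey] at h1 h2
    refine ⟨h1, fun a b hab => ?_⟩
    have := congrFun (congrFun h2 a) b
    rw [h1] at this
    simpa only [hab, not_false_eq_true, true_and, eq_iff_iff] using this
  refine sum_nbij Prod.snd ?_ ?_ ?_ (fun _ _ => rfl)
  · intro q hq
    simp only [mem_filter, mem_soleSinks] at hq
    rw [← (hkey _ _ hq.2).1]
    simp [InBasin.refl]
  · intro q hq r hr hqr
    simp only [coe_filter, mem_soleSinks, Set.mem_ofPred_eq] at hq hr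
    obtain ⟨hq1, hq2⟩ := hq
    obtain ⟨hr1, hr2⟩ := hr
    obtain ⟨hb, ha⟩ := hkey _ _ (hq2.trans hr2.symm)
    obtain ⟨q1, q2⟩ := q
    obtain ⟨r1, r2⟩ := r
    dsimp only at hqr hq1 hr1 hb ha
    subst hqr
    refine Prod.ext (eq_of_onlySink hq1 hr1 (fun z => ?_) fun a b hab => (ha a b ?_).1) rfl
    · rw [← mem_basin, hb, mem_basin]
    · rwa [← hb, mem_basin, mem_basin]
  · intro w hw
    simp only [coe_filter, mem_soleSinks, Set.mem_image, Set.mem_ofPred_eq]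
    obtain ⟨σ', h1, h2, h3⟩ := exists_reroot hp (mem_basin.1 hw)
    have hb : basin σ' w = basin p.1 p.2 := by
      ext z
      rw [mem_basin, h2, mem_basin]
    refine ⟨(σ', w), ⟨h1, ?_⟩, rfl⟩
    unfold basinKey
    simp only [hb, Prod.mk.injEq, true_and]
    funext a b
    refine propext (and_congr_right fun hab => h3 a b ?_)
    rwa [mem_basin, mem_basin] at hab

/-- The weight that an exit from a basin `W` carries. -/
def exitWeight (G : SimpleGraph V) (W : Finset V) : ℕ :=
  if #(boundary G W) = 1 then 2 * #W - 1 else Fintype.card V - 1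

/-- If the basin were everything, all edges would be arcs inside it, hence at most `n - 1` in
number, and a connected graph with so few edges is a tree. -/
theorem basin_ne_univ (hG : G.Connected) (hT : ¬ G.IsTree) (hv : OnlySink σ v) :
    basin σ v ≠ univ := by
  intro hW
  apply hT
  rw [SimpleGraph.isTree_iff_connected_and_card]
  refine ⟨hG, le_antisymm ?_ hG.card_vert_le_card_edgeSet_add_one⟩
  have h := card_arcs_inside_le hv
  rw [hW, card_univ] at h
  simp only [mem_univ, true_and] at h
  have h2 : Nat.card G.edgeSet ≤ #{p : V × V | Arc σ p.1 p.2} := by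
    rw [Nat.card_eq_fintype_card, ← card_univ]
    have hex : ∀ e : G.edgeSet, ∃ p : V × V, (e : Sym2 V) = s(p.1, p.2) ∧ Arc σ p.1 p.2 := by
      intro e
      obtain ⟨a, ha⟩ := Sym2.mem_iff_exists.1 (σ e).2
      have he : (e : Sym2 V) = s(a, (σ e).1) := ha.trans Sym2.eq_swap
      exact ⟨(a, (σ e).1), he, e, he, rfl⟩
    choose f hf hf' using hex
    refine card_le_card_of_injOn f (fun e _ => by simpa using hf' e) fun e _ e' _ h => ?_
    exact Subtype.ext (by rw [hf e, hf e', h])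
  have : 0 < Fintype.card V := Fintype.card_pos_iff.2 ⟨v⟩
  rw [Nat.card_eq_fintype_card (α := V)]
  omega

theorem boundary_nonempty (hG : G.Connected) {W : Finset V} (hW : W.Nonempty) (hW' : W ≠ univ) :
    (boundary G W).Nonempty := by
  obtain ⟨a, ha⟩ := hW
  obtain ⟨b, hb⟩ : ∃ b, b ∉ W := by
    by_contra! h
    exact hW' (eq_univ_iff_forall.2 h)
  obtain ⟨w⟩ := hG.preconnected a b
  obtain ⟨d, -, h1, h2⟩ := w.exists_boundary_dart (W : Set V) (by simpa using ha) (by simpa using hb)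
  exact ⟨(d.fst, d.snd), by
    rw [mem_boundary]; exact ⟨by simpa using h1, by simpa using h2, d.adj⟩⟩

theorem sum_degree_soleSinks_le (hG : G.Connected) (hT : ¬ G.IsTree) :
    ∑ p ∈ soleSinks G, G.degree p.2 ≤
      ∑ p ∈ soleSinks G, outer G (basin p.1 p.2) p.2 * exitWeight G (basin p.1 p.2) := by
  rw [← sum_fiberwise_of_maps_to (t := (soleSinks G).image basinKey)
    (fun p hp => mem_image_of_mem _ hp),
    ← sum_fiberwise_of_maps_to (t := (soleSinks G).image basinKey) (g := basinKey)
    (fun p hp => mem_image_of_mem _ hp)]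
  refine sum_le_sum fun k hk => ?_
  obtain ⟨p, hp, rfl⟩ := mem_image.1 hk
  rw [mem_soleSinks] at hp
  set W := basin p.1 p.2 with hW
  have h1 : ∑ q ∈ soleSinks G with basinKey q = basinKey p,
      outer G (basin q.1 q.2) q.2 * exitWeight G (basin q.1 q.2) =
      ∑ q ∈ soleSinks G with basinKey q = basinKey p, outer G W q.2 * exitWeight G W := by
    refine sum_congr rfl fun q hq => ?_
    rw [show basin q.1 q.2 = W from congrArg Prod.fst (mem_filter.1 hq).2]
  rw [h1, sum_fiber_basinKey hp (fun v => G.degree v),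
    sum_fiber_basinKey hp (fun v => outer G W v * exitWeight G W), ← sum_mul, sum_outer]
  refine (sum_degree_basin_le hp).trans ?_
  have hne : W ≠ univ := basin_ne_univ hG hT hp
  have hWn : W.Nonempty := ⟨p.2, by simp [hW, InBasin.refl]⟩
  have hd := (boundary_nonempty hG hWn hne).card_pos
  have hk : #W < Fintype.card V := by
    rw [← card_univ]
    exact card_lt_card (ssubset_univ_iff.2 hne)
  have hW0 := hWn.card_pos
  rw [← hW]
  unfold exitWeight
  -- With one boundary edge the weight is chosen to give equality. With `d ≥ 2` of them, `2 (|W| -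
  -- 1) + d ≤ d (n - 1)` because `|W| ≤ n - 1`.
  split_ifs with h
  · rw [h]; omega
  · have hd2 : 2 ≤ #(boundary G W) := by omega
    obtain ⟨d, hd'⟩ := Nat.exists_eq_add_of_le hd2
    obtain ⟨k, hk'⟩ := Nat.exists_eq_add_of_lt hk
    rw [hd', hk']
    have : #W + k + 1 - 1 = #W + k := by omega
    rw [this]
    obtain ⟨w, hw⟩ := Nat.exists_eq_add_of_lt hW0
    rw [hw]
    have : 0 + w + 1 - 1 = w := by omega
    rw [this]
    nlinarith [Nat.zero_le (d * (w + k)), Nat.zero_le k]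

end Counting

end SinkPopping

namespace SinkPopping

open scoped Classical
open Finset

/-! ### Charging exits to sink-free orientations -/

noncomputable section Exits

variable {V : Type*} [Fintype V] {G : SimpleGraph V} {σ τ : Orientation G} {a b c u v x y : V}

/-- Only `u` loses an outgoing arc. Had this been its only one, `u` would lie in the basin. -/
theorem isSinkFree_point (hv : OnlySink σ v) (h : G.Adj v u) (hu : u ∉ basin σ v) :
    IsSinkFree (point σ v u h) := by
  rw [isSinkFree_iff]
  intro w
  by_cases hwv : w = v
  · exact ⟨u, (arc_point h).2 (Or.inl ⟨hwv, rfl⟩)⟩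
  obtain ⟨y, hy⟩ := hv.exists_arc hwv
  by_cases hwy : w = u ∧ y = v
  · obtain ⟨rfl, rfl⟩ := hwy
    obtain ⟨z, hz, hzv⟩ : ∃ z, Arc σ w z ∧ z ≠ y := by
      by_contra! hn
      exact hu (mem_basin.2 (InBasin.head ⟨hy, hn⟩ .refl))
    exact ⟨z, (arc_point h).2 (Or.inr ⟨hz, fun h => hzv h.2⟩)⟩
  · exact ⟨y, (arc_point h).2 (Or.inr ⟨hy, hwy⟩)⟩

theorem inBasin_point (h : G.Adj v u) (hu : u ∉ basin σ v) (hx : InBasin σ v x) :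
    InBasin (point σ v u h) v x := by
  refine hx.mono fun z y hz hy hzy hy' => InBasin.head ⟨?_, fun w hw => ?_⟩ hy'
  · refine (arc_point h).2 (Or.inr ⟨hzy.1, ?_⟩)
    rintro ⟨rfl, rfl⟩
    exact hu (mem_basin.2 (InBasin.head hzy hy))
  · rcases (arc_point h).1 hw with h' | h'
    · exact absurd h'.1 hz
    · exact hzy.2 _ h'.1

/-- The basin of `v` hangs from a single edge, along which `v` has its only outgoing arc. -/
def Pendant (τ : Orientation G) (v : V) : Prop :=
  ∃ u, Single τ v u ∧ boundary G (basin τ v) = {(v, u)}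

/-- In general the basin can grow, since `u` may be left with a single arc that leads into it. When
`(v, u)` is the only boundary edge, before or after, this cannot happen. -/
theorem basin_point_eq (hv : OnlySink σ v) (h : G.Adj v u) (hu : u ∉ basin σ v)
    (hb : boundary G (basin σ v) = {(v, u)} ∨ boundary G (basin (point σ v u h) v) = {(v, u)}) :
    basin (point σ v u h) v = basin σ v := by
  ext x
  rw [mem_basin, mem_basin]
  refine ⟨fun hx => hx.mono fun a b ha hb' hab hb'' => ?_, inBasin_point h hu⟩
  rcases hb with hb | hb
  · by_contra hn
    have hm : (b, a) ∈ boundary G (basin σ v) := by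
      simpa [hb'', hn] using hab.1.adj.symm
    rw [hb, mem_singleton, Prod.mk.injEq] at hm
    obtain ⟨rfl, rfl⟩ := hm
    exact hab.1.asymm (single_point hv.1 h).1
  · have hau : a ≠ u := by
      rintro rfl
      have hm : (v, a) ∈ boundary G (basin (point σ v a h) v) := by rw [hb]; simp
      rw [mem_boundary, mem_basin, mem_basin] at hm
      exact hm.2.1 (InBasin.head hab hb')
    refine InBasin.head ⟨?_, fun w hw => ?_⟩ hb''
    · rcases (arc_point h).1 hab.1 with h' | h'
      · exact absurd h'.1 ha
      · exact h'.1
    · exact hab.2 w ((arc_point h).2 (Or.inr ⟨hw, fun h' => hau h'.1⟩))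

/-- The weight of an exit can thus be read off its target and `v` alone, without knowing `σ`. -/
theorem exitWeight_eq (hv : OnlySink σ v) (h : G.Adj v u) (hu : u ∉ basin σ v) :
    exitWeight G (basin σ v) = if Pendant (point σ v u h) v then
      2 * #(basin (point σ v u h) v) - 1 else Fintype.card V - 1 := by
  have hm : (v, u) ∈ boundary G (basin σ v) := by
    rw [mem_boundary]
    exact ⟨by simp [InBasin.refl], hu, h⟩
  unfold exitWeight
  by_cases hc : #(boundary G (basin σ v)) = 1
  · obtain ⟨p, hp⟩ := card_eq_one.1 hc
    have : p = (v, u) := by rw [hp, mem_singleton] at hm; exact hm.symm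
    subst this
    have he := basin_point_eq hv h hu (Or.inl hp)
    rw [if_pos hc, if_pos, he]
    exact ⟨u, single_point hv.1 h, by rw [he, hp]⟩
  · rw [if_neg hc, if_neg]
    rintro ⟨u', hs, hb⟩
    obtain rfl := hs.right_unique (single_point hv.1 h)
    rw [← basin_point_eq hv h hu (Or.inr hb), hb] at hc
    simp at hc

/-- If `x ≠ v`, the forced walk from `v` to `x` and back to `v` would put the successor `u` of `v`
into the basin, although `(v, u)` leaves it. -/
theorem Pendant.eq_of_inBasin (hv : Pendant τ v) (hx : InBasin τ v x) (hx' : InBasin τ x v) :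
    x = v := by
  by_contra hne
  obtain ⟨u, hs, hb⟩ := hv
  obtain ⟨y, hy, hyx⟩ := hx'.exists_single (Ne.symm hne)
  obtain rfl := hs.right_unique hy
  have hm : (v, u) ∈ boundary G (basin τ v) := by rw [hb]; simp
  rw [mem_boundary, mem_basin, mem_basin] at hm
  exact hm.2.1 (hyx.trans hx)

/-- With `Pendant.eq_of_inBasin` this makes basin membership a partial order on the pendant
vertices, which is what the count in `sum_exitWeight_le` needs. -/
theorem Pendant.of_inBasin (hv : Pendant τ v) (hx : InBasin τ v x) : Pendant τ x := by
  by_cases hxv : x = v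
  · rwa [hxv]
  obtain ⟨y, hxy, hy⟩ := hx.exists_single hxv
  refine ⟨y, hxy, ?_⟩
  -- Otherwise the forced walk from `x` closes into a cycle; the walk never leaves the basin of `x`,
  -- so `v` would lie there too, against antisymmetry.
  have hyx : ¬ InBasin τ x y := by
    intro hyx
    have key : ∀ z, Relation.ReflTransGen (Single τ) x z → InBasin τ x z := by
      intro z hz
      induction hz with
      | refl => exact .refl
      | tail h1 h2 ih =>
        rename_i b c
        by_cases hbx : b = x
        · subst hbx
          rwa [← hxy.right_unique h2]
        · obtain ⟨c', hc', hc''⟩ := ih.exists_single hbx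
          rwa [h2.right_unique hc']
    exact hxv (hv.eq_of_inBasin hx (key v hx))
  obtain ⟨u, hvu, hb⟩ := hv
  ext ⟨a, b⟩
  rw [mem_boundary, mem_basin, mem_basin, mem_singleton, Prod.mk.injEq]
  constructor
  · rintro ⟨ha, hbx, hab⟩
    have hav : InBasin τ v a := ha.trans hx
    rcases arc_or_arc (σ := τ) hab with hab' | hba
    · have hax : a = x := by
        by_contra hne
        exact hbx (ha.of_arc hne hab').2
      subst hax
      exact ⟨rfl, hxy.2 b hab'⟩
    · exfalso
      have hbv : InBasin τ v b := by
        by_contra hn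
        have hm : (a, b) ∈ boundary G (basin τ v) := by simp [hav, hn, hab]
        rw [hb, mem_singleton, Prod.mk.injEq] at hm
        obtain ⟨rfl, rfl⟩ := hm
        exact hba.asymm hvu.1
      by_cases hbv' : b = v
      · subst hbv'
        obtain rfl := hvu.2 a hba
        have hm : (b, a) ∈ boundary G (basin τ b) := by rw [hb]; simp
        rw [mem_boundary, mem_basin, mem_basin] at hm
        exact hm.2.1 hav
      · exact hbx (InBasin.head (hbv.of_arc hbv' hba).1 ha)
  · rintro ⟨rfl, rfl⟩
    exact ⟨.refl, hyx, hxy.1.adj⟩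

theorem sum_exitWeight_le (τ : Orientation G) :
    ∑ v : V, (if Pendant τ v then 2 * #(basin τ v) - 1 else Fintype.card V - 1) ≤
      Fintype.card V * (Fintype.card V - 1) := by
  rcases isEmpty_or_nonempty V with hV | hV
  · simp
  set P : Finset V := univ.filter (Pendant τ) with hP
  set n := Fintype.card V with hn
  have hPlt : #P ≤ n - 1 := by
    -- A vertex with a largest basin is not pendant: the basin of its successor would be strictly
    -- larger.
    obtain ⟨v, -, hmax⟩ := exists_max_image univ (fun v => #(basin τ v)) univ_nonempty
    have hvP : ¬ Pendant τ v := by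
      rintro ⟨u, hs, hb⟩
      have hm : (v, u) ∈ boundary G (basin τ v) := by rw [hb]; simp
      rw [mem_boundary] at hm
      have : basin τ v ⊂ basin τ u := by
        rw [ssubset_iff_of_subset]
        · exact ⟨u, by simp [InBasin.refl], hm.2.1⟩
        · intro z hz
          rw [mem_basin] at hz ⊢
          exact hz.trans (InBasin.head hs .refl)
      exact absurd (card_lt_card this) (not_lt.2 (hmax u (mem_univ _)))
    have : #P < n := by
      rw [hn, ← card_univ]
      exact card_lt_card (ssubset_univ_iff.2 fun h => hvP (by
        have := mem_univ v
        rw [← h, hP, mem_filter] at this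
        exact this.2))
    omega
  -- The pairs `D` of the partial order and their reversals lie in `P ×ˢ P` and overlap only on the
  -- diagonal, so `2 #D ≤ #P ^ 2 + #P`.
  have hsq : ∑ v ∈ P, (2 * #(basin τ v) - 1) ≤ #P * #P := by
    set D : Finset (V × V) := univ.filter fun p => Pendant τ p.1 ∧ InBasin τ p.1 p.2 with hD
    have hDc : ∑ v ∈ P, #(basin τ v) = #D := by
      have : D = (P.sigma fun v => basin τ v : Finset (Σ _ : V, V)).map
          (Equiv.sigmaEquivProd V V).toEmbedding := by
        ext ⟨a, b⟩
        simp [hD, hP]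
      rw [this, card_map, card_sigma]
    set D' := D.map (Equiv.prodComm V V).toEmbedding with hD'
    have h1 : D ∪ D' ⊆ P ×ˢ P := by
      rintro ⟨a, b⟩ h
      simp only [hD', hD, mem_union, mem_filter, mem_univ, true_and, mem_map_equiv,
        Equiv.prodComm_symm, Equiv.prodComm_apply, Prod.swap_prod_mk] at h
      simp only [hP, mem_product, mem_filter, mem_univ, true_and]
      rcases h with h | h
      · exact ⟨h.1, h.1.of_inBasin h.2⟩
      · exact ⟨h.1.of_inBasin h.2, h.1⟩
    have h2 : D ∩ D' ⊆ P.map ⟨fun a => (a, a), fun a b h => (Prod.mk.inj h).1⟩ := by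
      rintro ⟨a, b⟩ h
      simp only [hD', hD, mem_inter, mem_filter, mem_univ, true_and, mem_map_equiv,
        Equiv.prodComm_symm, Equiv.prodComm_apply, Prod.swap_prod_mk] at h
      obtain rfl := h.1.1.eq_of_inBasin h.1.2 h.2.2
      exact mem_map.2 ⟨b, by simpa [hP] using h.1.1, rfl⟩
    have h3 := card_union_add_card_inter D D'
    have h4 := card_le_card h1
    have h5 := card_le_card h2
    rw [card_product] at h4
    rw [card_map] at h5
    have h6 : #D' = #D := card_map _
    have h7 : ∑ v ∈ P, (2 * #(basin τ v) - 1) + #P = 2 * #D := by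
      rw [← hDc, mul_sum, card_eq_sum_ones, ← sum_add_distrib]
      refine sum_congr rfl fun v _ => ?_
      have : 0 < #(basin τ v) := card_pos.2 ⟨v, by simp [InBasin.refl]⟩
      omega
    omega
  have hQ : #P + #(univ.filter fun v => ¬ Pendant τ v) = n := by
    rw [hP, card_filter_add_card_filter_not, card_univ]
  rw [sum_ite, sum_const, smul_eq_mul, ← hQ, add_mul]
  refine Nat.add_le_add ?_ ?_
  · rw [hQ]
    exact hsq.trans (Nat.mul_le_mul_left _ hPlt)
  · exact le_rfl

/-- Triples `((σ, v), u)` with `v` the only sink of `σ` and `u` a neighbour outside its basin. -/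
def exits (G : SimpleGraph V) : Finset ((Orientation G × V) × V) :=
  univ.filter fun x => OnlySink x.1.1 x.1.2 ∧ x.2 ∉ basin x.1.1 x.1.2 ∧ G.Adj x.1.2 x.2

/-- The sink-free orientation that an exit leads to. -/
def exitTarget (x : (Orientation G × V) × V) : Orientation G :=
  if h : G.Adj x.1.2 x.2 then point x.1.1 x.1.2 x.2 h else x.1.1

/-- For a fixed target `τ`, the vertex `v` determines the exit: `u` is the head of the only arc
leaving `v`, and reversing that arc gives back `σ`. -/
theorem sum_exits_le : ∑ x ∈ exits G, exitWeight G (basin x.1.1 x.1.2) ≤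
    Fintype.card V * (Fintype.card V - 1) * #(sinkFree G) := by
  have hmem : ∀ x ∈ exits G, OnlySink x.1.1 x.1.2 ∧ x.2 ∉ basin x.1.1 x.1.2 ∧
      ∃ h : G.Adj x.1.2 x.2, exitTarget x = point x.1.1 x.1.2 x.2 h := by
    intro x hx
    simp only [exits, mem_filter, mem_univ, true_and] at hx
    exact ⟨hx.1, hx.2.1, hx.2.2, dif_pos hx.2.2⟩
  rw [← sum_fiberwise_of_maps_to (t := sinkFree G) (g := exitTarget), mul_comm, ← smul_eq_mul,
    ← sum_const]
  swap
  · intro x hx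
    obtain ⟨h1, h2, h3, h4⟩ := hmem x hx
    rw [h4, mem_sinkFree]
    exact isSinkFree_point h1 h3 h2
  refine sum_le_sum fun τ _ => le_trans ?_ (sum_exitWeight_le τ)
  set h : V → ℕ := fun v => if Pendant τ v then 2 * #(basin τ v) - 1 else Fintype.card V - 1
  have h1 : ∑ x ∈ exits G with exitTarget x = τ, exitWeight G (basin x.1.1 x.1.2) =
      ∑ x ∈ exits G with exitTarget x = τ, h x.1.2 := by
    refine sum_congr rfl fun x hx => ?_
    rw [mem_filter] at hx
    obtain ⟨h1, h2, h3, h4⟩ := hmem x hx.1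
    rw [exitWeight_eq h1 h3 h2, ← h4, hx.2]
  rw [h1, ← sum_image (f := h) (g := fun x : (Orientation G × V) × V => x.1.2)]
  · exact sum_le_sum_of_subset (subset_univ _)
  · intro x hx y hy hxy
    rw [mem_coe, mem_filter] at hx hy
    obtain ⟨hx1, hx2, hx3, hx4⟩ := hmem x hx.1
    obtain ⟨hy1, hy2, hy3, hy4⟩ := hmem y hy.1
    obtain ⟨⟨σ, v⟩, u⟩ := x
    obtain ⟨⟨σ', v'⟩, u'⟩ := y
    dsimp only at *
    subst hxy
    have hs := single_point hx1.1 hx3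
    have hs' := single_point hy1.1 hy3
    rw [← hx4, hx.2] at hs
    rw [← hy4, hy.2] at hs'
    obtain rfl := hs.right_unique hs'
    have e1 := point_point (hx1.1.arc_of_adj hx3)
    have e2 := point_point (hy1.1.arc_of_adj hy3)
    have : σ = σ' := by
      rw [← e1, ← e2]
      congr 1
      rw [← hx4, ← hy4, hx.2, hy.2]
    rw [this]

theorem sum_degree_soleSinks_le_mul_card_sinkFree (hG : G.Connected) (hT : ¬ G.IsTree) :
    ∑ p ∈ soleSinks G, G.degree p.2 ≤
      Fintype.card V * (Fintype.card V - 1) * #(sinkFree G) := by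
  refine (sum_degree_soleSinks_le hG hT).trans (le_trans (le_of_eq ?_) sum_exits_le)
  have : exits G = ((soleSinks G).sigma fun p => {u | u ∉ basin p.1 p.2 ∧ G.Adj p.2 u} :
      Finset (Σ _ : Orientation G × V, V)).map (Equiv.sigmaEquivProd _ V).toEmbedding := by
    ext ⟨⟨a, b⟩, c⟩
    simp [exits]
  rw [this, sum_map, sum_sigma]
  refine sum_congr rfl fun p _ => ?_
  simp [outer]

end Exits

end SinkPopping

namespace SinkPopping

open scoped Classical
open Finset

/-! ### Forcing a set of vertices to be sinks -/

noncomputable section Forcing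

variable {V : Type*} {G : SimpleGraph V} {σ τ : Orientation G} {u v x y : V}

/-- Orient every edge towards an endpoint nearest to `w`; the first step of a shortest path then
leaves every other vertex. -/
theorem exists_onlySink (hG : G.Connected) (w : V) : ∃ σ : Orientation G, OnlySink σ w := by
  have hex : ∀ e : G.edgeSet, ∃ h : Head G e, ∀ x ∈ (e : Sym2 V), G.dist h.1 w ≤ G.dist x w := by
    rintro ⟨e, he⟩
    induction e with
    | h a b =>
      rcases le_total (G.dist a w) (G.dist b w) with h | h
      · refine ⟨⟨a, Sym2.mem_mk_left _ _⟩, fun x hx => ?_⟩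
        rcases Sym2.mem_iff.1 hx with rfl | rfl
        exacts [le_rfl, h]
      · refine ⟨⟨b, Sym2.mem_mk_right _ _⟩, fun x hx => ?_⟩
        rcases Sym2.mem_iff.1 hx with rfl | rfl
        exacts [h, le_rfl]
  choose σ hσ using hex
  refine ⟨σ, fun e he => ?_, fun x hx => ?_⟩
  · have := hσ e w he
    rw [SimpleGraph.dist_self, Nat.le_zero] at this
    exact (hG.dist_eq_zero_iff).1 this
  · by_contra hne
    obtain ⟨p, hp⟩ := hG.exists_walk_length_eq_dist x w
    cases p with
    | nil => exact hne rfl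
    | cons h p =>
      rename_i y
      have h1 := hσ ⟨s(x, y), G.mem_edgeSet.2 h⟩ y (Sym2.mem_mk_right _ _)
      rw [hx _ (Sym2.mem_mk_left _ _)] at h1
      have h2 := SimpleGraph.dist_le p
      rw [SimpleGraph.Walk.length_cons] at hp
      omega

variable [Fintype V] {S T : Finset V}

/-- The set of sinks of an orientation. -/
def sinks (σ : Orientation G) : Finset V := univ.filter (IsSink σ)

@[simp] theorem mem_sinks : v ∈ sinks σ ↔ IsSink σ v := by simp [sinks]

theorem sinks_eq_empty_iff : sinks σ = ∅ ↔ IsSinkFree σ := by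
  simp [eq_empty_iff_forall_notMem, IsSinkFree]

theorem sinks_eq_singleton_iff : sinks σ = {v} ↔ OnlySink σ v := by
  rw [eq_singleton_iff_unique_mem]
  simp [OnlySink]

/-- The edges that touch `S`. -/
def incident (G : SimpleGraph V) (S : Finset V) : Finset G.edgeSet :=
  univ.filter fun e => ∃ v ∈ S, v ∈ (e : Sym2 V)

@[simp] theorem mem_incident {e : G.edgeSet} :
    e ∈ incident G S ↔ ∃ v ∈ S, v ∈ (e : Sym2 V) := by simp [incident]

theorem sinkEdges_eq_incident (σ : Orientation G) : sinkEdges σ = incident G (sinks σ) := by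
  ext e
  simp [sinkEdges, and_comm]

/-- No two vertices of `S` are adjacent. -/
def Indep (G : SimpleGraph V) (S : Finset V) : Prop := ∀ a ∈ S, ∀ b ∈ S, ¬ G.Adj a b

/-- The vertices of `S` and their neighbours. -/
def closedNbhd (G : SimpleGraph V) (S : Finset V) : Finset V :=
  univ.filter fun w => w ∈ S ∨ ∃ s ∈ S, G.Adj s w

@[simp] theorem mem_closedNbhd :
    x ∈ closedNbhd G S ↔ x ∈ S ∨ ∃ s ∈ S, G.Adj s x := by simp [closedNbhd]

theorem subset_closedNbhd : S ⊆ closedNbhd G S := fun x hx => by simp [hx]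

theorem indep_of_subset_sinks (h : S ⊆ sinks σ) : Indep G S := fun _ ha _ hb =>
  (mem_sinks.1 (h ha)).not_adj (mem_sinks.1 (h hb))

/-- The orientation `σ` with the edges at `S` redirected to `S`. -/
def force (S : Finset V) (σ : Orientation G) : Orientation G := fun e =>
  if h : ∃ v ∈ S, v ∈ (e : Sym2 V) then ⟨h.choose, h.choose_spec.2⟩ else σ e

theorem force_of_notMem {e : G.edgeSet} (h : e ∉ incident G S) : force S σ e = σ e :=
  dif_neg fun h' => h (mem_incident.2 h')

theorem subset_sinks_force (hS : Indep G S) : S ⊆ sinks (force S σ) := by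
  intro v hv
  rw [mem_sinks]
  intro e he
  have h : ∃ v ∈ S, v ∈ (e : Sym2 V) := ⟨v, hv, he⟩
  have h1 : (force S σ e).1 = h.choose := congrArg Subtype.val (dif_pos h)
  rw [h1]
  by_contra hne
  have h2 := h.choose_spec
  have h3 : (e : Sym2 V) = s(h.choose, v) := (Sym2.mem_and_mem_iff hne).1 ⟨h2.2, he⟩
  have h4 := e.2
  rw [h3] at h4
  exact hS _ h2.1 _ hv h4

theorem eq_force_iff (hσ : S ⊆ sinks σ) :
    σ = force S τ ↔ ∀ e ∉ incident G S, τ e = σ e := by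
  constructor
  · rintro rfl e he
    exact (force_of_notMem he).symm
  · intro h
    funext e
    by_cases he : e ∈ incident G S
    · obtain ⟨v, hv, hve⟩ := mem_incident.1 he
      refine Subtype.ext ?_
      rw [mem_sinks.1 (hσ hv) e hve,
        mem_sinks.1 (subset_sinks_force (indep_of_subset_sinks hσ) hv) e hve]
    · rw [force_of_notMem he, h e he]

/-- Neighbours of `S` outside `S` get an arc into `S`, and vertices outside the closed neighbourhood
keep all their edges. -/
theorem sinks_force (hS : Indep G S) :
    sinks (force S σ) = S ∪ (sinks σ \ closedNbhd G S) := by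
  have hsub := subset_sinks_force (σ := σ) hS
  ext w
  rw [mem_union, mem_sdiff, mem_sinks, mem_sinks]
  constructor
  · intro hw
    by_cases hwS : w ∈ S
    · exact Or.inl hwS
    have hwN : w ∉ closedNbhd G S := by
      rw [mem_closedNbhd]
      rintro (h | ⟨s, hs, hsw⟩)
      · exact hwS h
      · exact (mem_sinks.1 (hsub hs)).not_adj hw hsw
    refine Or.inr ⟨fun e he => ?_, hwN⟩
    rw [← hw e he, force_of_notMem]
    rw [mem_incident]
    rintro ⟨s, hs, hse⟩
    refine hwN (mem_closedNbhd.2 (Or.inr ⟨s, hs, ?_⟩))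
    have h3 := (Sym2.mem_and_mem_iff (fun h : s = w => hwS (h ▸ hs))).1 ⟨hse, he⟩
    have h4 := e.2
    rwa [h3] at h4
  · rintro (h | ⟨hw, hwN⟩)
    · exact mem_sinks.1 (hsub h)
    · intro e he
      rw [force_of_notMem, hw e he]
      rw [mem_incident]
      rintro ⟨s, hs, hse⟩
      refine hwN (mem_closedNbhd.2 ?_)
      by_cases hsw : s = w
      · exact Or.inl (hsw ▸ hs)
      · have h3 := (Sym2.mem_and_mem_iff hsw).1 ⟨hse, he⟩
        have h4 := e.2
        rw [h3] at h4
        exact Or.inr ⟨s, hs, h4⟩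

theorem sinks_force_eq_self_iff (hS : Indep G S) :
    sinks (force S σ) = S ↔ sinks σ ⊆ closedNbhd G S := by
  rw [sinks_force hS, union_eq_left]
  constructor
  · intro h x hx
    by_contra hn
    exact hn (subset_closedNbhd (h (mem_sdiff.2 ⟨hx, hn⟩)))
  · intro h
    rw [sdiff_eq_empty_iff_subset.2 h]
    exact empty_subset _

theorem sinks_force_eq_insert_iff (hS : Indep G S) (hv : v ∉ closedNbhd G S) :
    sinks (force S σ) = insert v S ↔ v ∈ sinks σ ∧ (sinks σ).erase v ⊆ closedNbhd G S := by
  rw [sinks_force hS]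
  have hvS : v ∉ S := fun h => hv (subset_closedNbhd h)
  constructor
  · intro h
    have key : ∀ x, x ∈ sinks σ → x ∉ closedNbhd G S → x = v := by
      intro x hx hxN
      have : x ∈ insert v S := by rw [← h]; simp only [mem_union, mem_sdiff]; exact Or.inr ⟨hx, hxN⟩
      rw [mem_insert] at this
      exact this.resolve_right fun h => hxN (subset_closedNbhd h)
    constructor
    · have : v ∈ S ∪ (sinks σ \ closedNbhd G S) := by rw [h]; exact mem_insert_self _ _
      rw [mem_union, mem_sdiff] at this
      exact (this.resolve_left hvS).1
    · intro x hx
      rw [mem_erase] at hx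
      by_contra hxN
      exact hx.1 (key x hx.2 hxN)
  · rintro ⟨h1, h2⟩
    ext x
    rw [mem_union, mem_sdiff, mem_insert]
    constructor
    · rintro (h | ⟨h, h'⟩)
      · exact Or.inr h
      · left
        by_contra hne
        exact h' (h2 (mem_erase.2 ⟨hne, h⟩))
    · rintro (rfl | h)
      · exact Or.inr ⟨h1, hv⟩
      · exact Or.inl h

theorem card_head (e : G.edgeSet) : Fintype.card (Head G e) = 2 := by
  obtain ⟨e, he⟩ := e
  induction e with
  | h a b =>
    have hne : a ≠ b := G.ne_of_adj he
    rw [← Nat.card_eq_fintype_card]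
    have : {v : V | v ∈ s(a, b)} = {a, b} := by ext; simp
    have h2 : Nat.card {v : V | v ∈ s(a, b)} = 2 := by
      rw [this, Nat.card_coe_set_eq, Set.ncard_pair hne]
    exact h2

theorem card_agree_off (I : Finset G.edgeSet) (σ : Orientation G) :
    #{τ : Orientation G | ∀ e ∉ I, τ e = σ e} = 2 ^ #I := by
  have : ({τ : Orientation G | ∀ e ∉ I, τ e = σ e} : Finset (Orientation G)) =
      Fintype.piFinset fun e => if e ∈ I then univ else {σ e} := by
    ext τ
    simp only [mem_filter, mem_univ, true_and, Fintype.mem_piFinset]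
    refine forall_congr' fun e => ?_
    split_ifs with h <;> simp [h]
  rw [this, Fintype.card_piFinset]
  have h2 : ∀ e : G.edgeSet, #(if e ∈ I then univ else {σ e} : Finset (Head G e)) =
      if e ∈ I then 2 else 1 := by
    intro e
    split_ifs
    · rw [card_univ, card_head]
    · simp
  simp_rw [h2]
  rw [prod_ite_mem, univ_inter, prod_const]

/-- `force S` forgets exactly the directions of the edges touching `S`. -/
theorem card_filter_force (hS : Indep G S) (P : Orientation G → Prop) :
    #{τ : Orientation G | P (force S τ)} =
      2 ^ #(incident G S) * #{σ : Orientation G | S ⊆ sinks σ ∧ P σ} := by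
  rw [card_eq_sum_card_fiberwise (f := force S) (t := {σ : Orientation G | S ⊆ sinks σ ∧ P σ})]
  · rw [mul_comm, ← smul_eq_mul, ← sum_const]
    refine sum_congr rfl fun σ hσ => ?_
    simp only [mem_filter, mem_univ, true_and] at hσ
    rw [← card_agree_off (incident G S) σ, filter_filter]
    congr 1
    ext τ
    simp only [mem_filter, mem_univ, true_and]
    rw [← eq_force_iff hσ.1]
    constructor
    · exact fun h => h.2.symm
    · exact fun h => ⟨h ▸ hσ.2, h.symm⟩
  · intro τ hτ
    simp only [coe_filter, mem_univ, true_and, Set.mem_ofPred_eq] at hτ ⊢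
    exact ⟨subset_sinks_force hS, hτ⟩

end Forcing

end SinkPopping

namespace SinkPopping

open scoped Classical
open Finset

/-! ### The mass recursion and its telescoping sum -/

noncomputable section Mass

variable {V : Type*} [Fintype V] {G : SimpleGraph V} {σ τ : Orientation G} {v : V}
  {S T T' : Finset V} {t : ℕ}

/-- `mass G t T` is the probability that after `t` rounds the state is a given orientation with
set of sinks `T`. -/
def mass (G : SimpleGraph V) : ℕ → Finset V → ℝ≥0∞
  | 0, _ => 2⁻¹ ^ Fintype.card G.edgeSet
  | t + 1, T => ∑ S : Finset V with Indep G S ∧ T ⊆ closedNbhd G S,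
      2⁻¹ ^ #(incident G S) * mass G t S

theorem mass_anti (t : ℕ) (h : T ⊆ T') : mass G t T' ≤ mass G t T := by
  cases t with
  | zero => exact le_rfl
  | succ t =>
    refine sum_le_sum_of_subset fun S hS => ?_
    simp only [mem_filter, mem_univ, true_and] at hS ⊢
    exact ⟨hS.1, h.trans hS.2⟩

/-- A predecessor of `τ` with sink set `S` can only be `force S τ`, and that one has sink set `S`
exactly when `S` is independent and all sinks of `τ` lie in its closed neighbourhood. -/
theorem mass_step (t : ℕ) (τ : Orientation G) :
    ∑ σ : Orientation G with ∀ e ∉ incident G (sinks σ), τ e = σ e,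
      2⁻¹ ^ #(incident G (sinks σ)) * mass G t (sinks σ) = mass G (t + 1) (sinks τ) := by
  rw [← sum_fiberwise_of_maps_to (t := univ) (g := sinks) (fun _ _ => mem_univ _), mass, sum_filter]
  refine sum_congr rfl fun S _ => ?_
  have h1 : ∀ σ ∈ (univ.filter fun σ : Orientation G =>
      ∀ e ∉ incident G (sinks σ), τ e = σ e).filter (fun σ => sinks σ = S),
      2⁻¹ ^ #(incident G (sinks σ)) * mass G t (sinks σ) =
        2⁻¹ ^ #(incident G S) * mass G t S := by
    intro σ hσ
    rw [(mem_filter.1 hσ).2]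
  rw [sum_congr rfl h1, sum_const]
  have h2 : ∀ σ : Orientation G, σ ∈ (univ.filter fun σ : Orientation G =>
      ∀ e ∉ incident G (sinks σ), τ e = σ e).filter (fun σ => sinks σ = S) ↔
      σ = force S τ ∧ Indep G S ∧ sinks τ ⊆ closedNbhd G S := by
    intro σ
    rw [mem_filter, mem_filter, and_iff_right (mem_univ _)]
    constructor
    · rintro ⟨h, rfl⟩
      have hI : Indep G (sinks σ) := indep_of_subset_sinks Subset.rfl
      have h' := (eq_force_iff Subset.rfl).2 h
      refine ⟨h', hI, (sinks_force_eq_self_iff hI).1 ?_⟩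
      rw [← h']
    · rintro ⟨rfl, hI, hs⟩
      have := (sinks_force_eq_self_iff hI).2 hs
      rw [this]
      exact ⟨(eq_force_iff this.ge).1 rfl, rfl⟩
  split_ifs with h
  · rw [card_eq_one.2 ⟨force S τ, ?_⟩, one_smul]
    ext σ
    rw [h2, mem_singleton, and_iff_left h]
  · rw [card_eq_zero.2, zero_smul]
    rw [eq_empty_iff_forall_notMem]
    intro σ hσ
    exact h ((h2 σ).1 hσ).2

/-- The probability that `v` is a sink after `t` rounds. -/
def sinkMass (G : SimpleGraph V) (t : ℕ) (v : V) : ℝ≥0∞ :=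
  ∑ σ : Orientation G with v ∈ sinks σ, mass G t (sinks σ)

/-- The expected number of rounds up to `t` after which `v` is a sink, in closed form. -/
def cumMass (G : SimpleGraph V) (t : ℕ) (v : V) : ℝ≥0∞ :=
  ∑ σ : Orientation G with v ∈ sinks σ, mass G t ((sinks σ).erase v)

theorem cumMass_zero (v : V) : cumMass G 0 v = sinkMass G 0 v := rfl

theorem card_erase_sinks (hS : Indep G S) (hv : v ∉ closedNbhd G S) :
    #{σ : Orientation G | v ∈ sinks σ ∧ (sinks σ).erase v ⊆ closedNbhd G S} =
      2 ^ #(incident G S) * #{σ : Orientation G | v ∈ sinks σ ∧ (sinks σ).erase v = S} := by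
  have h := card_filter_force (G := G) hS (fun σ => sinks σ = insert v S)
  have hvS : v ∉ S := fun h => hv (subset_closedNbhd h)
  simp_rw [sinks_force_eq_insert_iff hS hv] at h
  rw [h]
  congr 2
  ext σ
  simp only [mem_filter, mem_univ, true_and]
  constructor
  · rintro ⟨-, h⟩
    rw [h]
    exact ⟨mem_insert_self _ _, erase_insert hvS⟩
  · rintro ⟨h1, rfl⟩
    exact ⟨erase_subset _ _, (insert_erase h1).symm⟩

/-- Split the recursion for `(sinks σ).erase v` by whether `v` lies in the closed neighbourhood of
`S`. The terms where it does form the mass of `sinks σ`. In the others, `card_erase_sinks` yields a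
factor `2 ^ #(incident G S)` that cancels the redrawing probability, leaving the previous `cumMass`.
-/
theorem cumMass_succ (t : ℕ) (v : V) :
    cumMass G (t + 1) v = cumMass G t v + sinkMass G (t + 1) v := by
  have key : ∀ σ : Orientation G, v ∈ sinks σ → mass G (t + 1) ((sinks σ).erase v) =
      (∑ S : Finset V with Indep G S ∧ v ∉ closedNbhd G S,
        if (sinks σ).erase v ⊆ closedNbhd G S then 2⁻¹ ^ #(incident G S) * mass G t S else 0) +
      mass G (t + 1) (sinks σ) := by
    intro σ hσ
    rw [mass, mass, ← sum_filter, filter_filter, add_comm, ← sum_filter_add_sum_filter_not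
      (univ.filter fun S => Indep G S ∧ (sinks σ).erase v ⊆ closedNbhd G S)
      (fun S => v ∈ closedNbhd G S), filter_filter, filter_filter]
    congr 2
    · ext S
      simp only [mem_filter, mem_univ, true_and, and_assoc]
      refine and_congr_right fun _ => ?_
      constructor
      · rintro ⟨h1, h2⟩ x hx
        by_cases hxv : x = v
        · exact hxv ▸ h2
        · exact h1 (mem_erase.2 ⟨hxv, hx⟩)
      · exact fun h => ⟨(erase_subset _ _).trans h, h hσ⟩
    · ext S
      simp only [mem_filter, mem_univ, true_and, and_assoc]
      exact and_congr_right fun _ => and_comm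
  have h1 : cumMass G (t + 1) v = (∑ σ : Orientation G with v ∈ sinks σ,
      ∑ S : Finset V with Indep G S ∧ v ∉ closedNbhd G S,
        if (sinks σ).erase v ⊆ closedNbhd G S then 2⁻¹ ^ #(incident G S) * mass G t S else 0) +
      sinkMass G (t + 1) v := by
    rw [cumMass, sinkMass, ← sum_add_distrib]
    exact sum_congr rfl fun σ hσ => key σ (mem_filter.1 hσ).2
  rw [h1, sum_comm]
  congr 1
  rw [cumMass, ← sum_fiberwise_of_maps_to
    (t := univ.filter fun S => Indep G S ∧ v ∉ closedNbhd G S) (g := fun σ => (sinks σ).erase v)]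
  · refine sum_congr rfl fun S hS => ?_
    obtain ⟨hI, hv⟩ := (mem_filter.1 hS).2
    rw [← sum_filter, filter_filter, filter_filter, sum_const, card_erase_sinks hI hv]
    have h2 : ∀ σ ∈ (univ.filter fun σ : Orientation G => v ∈ sinks σ ∧ (sinks σ).erase v = S),
        mass G t ((sinks σ).erase v) = mass G t S := by
      intro σ hσ
      rw [(mem_filter.1 hσ).2.2]
    rw [sum_congr rfl h2, sum_const, nsmul_eq_mul, nsmul_eq_mul, Nat.cast_mul, Nat.cast_pow,
      Nat.cast_ofNat]
    have h3 : (2 : ℝ≥0∞) ^ #(incident G S) * 2⁻¹ ^ #(incident G S) = 1 := by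
      rw [← mul_pow, ENNReal.mul_inv_cancel (by norm_num) (by norm_num), one_pow]
    calc _ = ((2 : ℝ≥0∞) ^ #(incident G S) * 2⁻¹ ^ #(incident G S)) *
          (#{σ : Orientation G | v ∈ sinks σ ∧ (sinks σ).erase v = S} * mass G t S) := by ring
      _ = _ := by rw [h3, one_mul]
  · intro σ hσ
    have hv := (mem_filter.1 hσ).2
    refine mem_filter.2 ⟨mem_univ _, indep_of_subset_sinks (erase_subset _ _), ?_⟩
    rw [mem_closedNbhd]
    rintro (h | ⟨s, hs, hsv⟩)
    · exact notMem_erase _ _ h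
    · exact (mem_sinks.1 (mem_of_mem_erase hs)).not_adj (mem_sinks.1 hv) hsv

theorem sum_range_sinkMass (t : ℕ) (v : V) :
    ∑ s ∈ range (t + 1), sinkMass G s v = cumMass G t v := by
  induction t with
  | zero => rw [zero_add, sum_range_one, cumMass_zero]
  | succ t ih => rw [sum_range_succ, ih, cumMass_succ]

end Mass

end SinkPopping

namespace SinkPopping

open scoped Classical
open Finset Filter Topology

/-! ### The law of the run, its limit and the expected cost -/

section Law

variable {V : Type*} {G : SimpleGraph V} {σ τ : Orientation G} {v : V}
  {S T : Finset V} {t : ℕ}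

theorem run_congr {ω ω' : Draws G} {t : ℕ} (h : ∀ s ≤ t, ∀ e, ω (s, e) = ω' (s, e)) :
    run ω t = run ω' t := by
  induction t with
  | zero => exact funext fun e => h 0 le_rfl e
  | succ t ih =>
    have h1 := ih fun s hs e => h s (hs.trans t.le_succ) e
    funext e
    simp only [run, h1, h (t + 1) le_rfl e]

theorem run_zero (ω : Draws G) (e : G.edgeSet) : run ω 0 e = ω (0, e) := rfl

theorem run_succ (ω : Draws G) (t : ℕ) (e : G.edgeSet) :
    run ω (t + 1) e = if e ∈ sinkEdges (run ω t) then ω (t + 1, e) else run ω t e := rfl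

theorem run_eq_of_isSinkFree {ω : Draws G} {s t : ℕ} (h : IsSinkFree (run ω s)) (hst : s ≤ t) :
    run ω t = run ω s := by
  induction t, hst using Nat.le_induction with
  | base => rfl
  | succ t _ ih =>
    funext e
    rw [run_succ, ih, if_neg]
    rintro ⟨v, -, hv⟩
    exact h v hv

theorem output_eq {ω : Draws G} (h : IsSinkFree (run ω t)) : output ω = run ω t := by
  have h1 : IsSinkFree (run ω (sInf {t | IsSinkFree (run ω t)})) :=
    Nat.sInf_mem (s := {t | IsSinkFree (run ω t)}) ⟨t, h⟩
  exact (run_eq_of_isSinkFree h1 (Nat.sInf_le h)).symm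

variable [Fintype V]

instance : IsProbabilityMeasure (drawLaw G) := by
  unfold drawLaw
  infer_instance

theorem uniformOn_univ_head (e : G.edgeSet) (h : Head G e) :
    uniformOn (Set.univ : Set (Head G e)) {h} = 2⁻¹ := by
  rw [uniformOn_univ, Measure.count_singleton, card_head, one_div, Nat.cast_ofNat]

theorem drawLaw_round (t : ℕ) (I : Finset G.edgeSet) (τ : Orientation G) :
    drawLaw G {ω | ∀ e ∈ I, ω (t, e) = τ e} = 2⁻¹ ^ #I := by
  have h1 : {ω : Draws G | ∀ e ∈ I, ω (t, e) = τ e} =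
      Set.pi (I.map ⟨Prod.mk t, Prod.mk_right_injective t⟩ : Finset (ℕ × G.edgeSet))
        (fun p : ℕ × G.edgeSet => ({τ p.2} : Set (Head G p.2))) := by
    ext ω
    rw [Set.mem_pi]
    constructor
    · intro h p hp
      obtain ⟨e, he, rfl⟩ := mem_map.1 hp
      exact h e he
    · exact fun h e he => h (t, e) (mem_map_of_mem _ he)
  rw [h1]
  refine (Measure.infinitePi_pi _ fun i _ => measurableSet_singleton _).trans ?_
  rw [prod_map]
  exact (prod_congr rfl fun e _ => uniformOn_univ_head e (τ e)).trans (prod_const _)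

theorem measurable_run (t : ℕ) : Measurable fun ω : Draws G => run ω t := by
  induction t with
  | zero =>
    rw [measurable_pi_iff]
    exact fun e => measurable_pi_apply (0, e)
  | succ t ih =>
    rw [measurable_pi_iff]
    intro e
    have h1 : MeasurableSet {ω : Draws G | e ∈ sinkEdges (run ω t)} :=
      ih (Set.toFinite {σ : Orientation G | e ∈ sinkEdges σ}).measurableSet
    exact Measurable.ite h1 (measurable_pi_apply (t + 1, e)) ((measurable_pi_apply e).comp ih)

theorem measurableSet_run (t : ℕ) (A : Set (Orientation G)) :
    MeasurableSet {ω : Draws G | run ω t ∈ A} :=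
  measurable_run t (Set.toFinite A).measurableSet

theorem drawLaw_run_inter (t : ℕ) (σ τ : Orientation G) (I : Finset G.edgeSet) :
    drawLaw G ({ω | run ω t = σ} ∩ {ω | ∀ e ∈ I, ω (t + 1, e) = τ e}) =
      drawLaw G {ω | run ω t = σ} * 2⁻¹ ^ #I := by
  set A : Finset (ℕ × G.edgeSet) := range (t + 1) ×ˢ univ with hA
  set B : Finset (ℕ × G.edgeSet) := {t + 1} ×ˢ univ with hB
  have hAB : Disjoint A B := by
    rw [Finset.disjoint_left]
    rintro ⟨s, e⟩ hs hs'
    simp only [hA, hB, mem_product, mem_range, mem_singleton] at hs hs'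
    omega
  have hind : iIndepFun (fun (p : ℕ × G.edgeSet) (ω : Draws G) => ω p) (drawLaw G) :=
    iIndepFun_infinitePi (X := fun _ x => x) (fun _ => measurable_id)
  have h2 := hind.indepFun_finset A B hAB (fun p => measurable_pi_apply p)
  -- By `run_congr` the state depends only on the finitely many draws in `A`, so any extension `ω`
  -- of them decides the event.
  set C : Set ((p : A) → Head G p.1.2) :=
    {c | ∃ ω : Draws G, (∀ p : A, c p = ω p) ∧ run ω t = σ} with hC
  set D : Set ((p : B) → Head G p.1.2) :=
    {c | ∀ p : B, p.1.2 ∈ I → c p = τ p.1.2} with hD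
  have h3 := h2.measure_inter_preimage_eq_mul C D (Set.toFinite _).measurableSet
    (Set.toFinite _).measurableSet
  have hC' : (fun (ω : Draws G) (p : A) => ω p) ⁻¹' C = {ω | run ω t = σ} := by
    ext ω
    constructor
    · rintro ⟨ω', h, h'⟩
      rw [Set.mem_ofPred_eq, ← h']
      refine run_congr fun s hs e => ?_
      exact h ⟨(s, e), by simp [hA, Nat.lt_succ_of_le hs]⟩
    · exact fun h => ⟨ω, fun _ => rfl, h⟩
  have hD' : (fun (ω : Draws G) (p : B) => ω p) ⁻¹' D =
      {ω | ∀ e ∈ I, ω (t + 1, e) = τ e} := by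
    ext ω
    constructor
    · exact fun h e he => h ⟨(t + 1, e), by simp [hB]⟩ he
    · rintro h ⟨⟨s, e⟩, hp⟩ he
      obtain rfl : s = t + 1 := by simpa [hB, eq_comm] using hp
      exact h e he
  rw [hC', hD', drawLaw_round] at h3
  exact h3

theorem drawLaw_run (t : ℕ) (τ : Orientation G) :
    drawLaw G {ω | run ω t = τ} = mass G t (sinks τ) := by
  induction t generalizing τ with
  | zero =>
    have h := drawLaw_round (G := G) 0 univ τ
    rw [mass, ← card_univ, ← h]
    congr 1
    ext ω
    simp [funext_iff, run_zero]
  | succ t ih =>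
    rw [← mass_step]
    have h1 : {ω : Draws G | run ω (t + 1) = τ} =
        ⋃ σ ∈ (univ.filter fun σ : Orientation G => ∀ e ∉ incident G (sinks σ), τ e = σ e),
          ({ω | run ω t = σ} ∩ {ω | ∀ e ∈ incident G (sinks σ), ω (t + 1, e) = τ e}) := by
      ext ω
      simp only [Set.mem_iUnion, Set.mem_inter_iff, Set.mem_ofPred_eq, mem_filter, mem_univ,
        true_and, exists_prop]
      have hs : ∀ e, e ∈ sinkEdges (run ω t) ↔ e ∈ incident G (sinks (run ω t)) := by
        intro e
        rw [sinkEdges_eq_incident, mem_coe]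
      constructor
      · rintro rfl
        refine ⟨run ω t, fun e he => ?_, rfl, fun e he => ?_⟩
        · rw [run_succ, if_neg (fun h => he ((hs e).1 h))]
        · rw [run_succ, if_pos ((hs e).2 he)]
      · rintro ⟨σ, h1, rfl, h2⟩
        funext e
        rw [run_succ]
        split_ifs with h
        · exact h2 e ((hs e).1 h)
        · exact (h1 e (fun h' => h ((hs e).2 h'))).symm
    rw [h1, measure_biUnion_finset]
    · refine sum_congr rfl fun σ _ => ?_
      rw [drawLaw_run_inter, ih, mul_comm]
    · intro σ _ σ' _ hne
      refine Set.disjoint_left.2 fun ω h h' => hne ?_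
      exact h.1.symm.trans h'.1
    · intro σ _
      refine (measurableSet_run t {σ}).inter ?_
      have : {ω : Draws G | ∀ e ∈ incident G (sinks σ), ω (t + 1, e) = τ e} =
          ⋂ e ∈ incident G (sinks σ), (fun ω : Draws G => ω (t + 1, e)) ⁻¹' {τ e} := by
        ext ω
        simp only [Set.mem_ofPred_eq, Set.mem_iInter, Set.mem_preimage, Set.mem_singleton_iff]
      rw [this]
      exact Finset.measurableSet_biInter _ fun e _ =>
        measurable_pi_apply (t + 1, e) (measurableSet_singleton _)

theorem drawLaw_run_mem (t : ℕ) (A : Finset (Orientation G)) :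
    drawLaw G {ω | run ω t ∈ A} = ∑ σ ∈ A, mass G t (sinks σ) := by
  have : {ω : Draws G | run ω t ∈ A} = ⋃ σ ∈ A, {ω | run ω t = σ} := by
    ext ω
    simp
  rw [this, measure_biUnion_finset]
  · exact sum_congr rfl fun σ _ => drawLaw_run t σ
  · intro σ _ σ' _ hne
    exact Set.disjoint_left.2 fun ω h h' => hne (h.symm.trans h')
  · exact fun σ _ => measurableSet_run t {σ}

theorem sum_mass (t : ℕ) : ∑ σ : Orientation G, mass G t (sinks σ) = 1 := by
  rw [← drawLaw_run_mem]
  simp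

theorem card_sinkFree_mul_mass_add (t : ℕ) :
    #(sinkFree G) * mass G t ∅ +
      ∑ σ : Orientation G with ¬ IsSinkFree σ, mass G t (sinks σ) = 1 := by
  rw [← sum_mass (G := G) t, ← sum_filter_add_sum_filter_not univ IsSinkFree, ← nsmul_eq_mul,
    ← sum_const]
  congr 1
  refine sum_congr rfl fun σ hσ => ?_
  rw [sinks_eq_empty_iff.2 (mem_sinkFree.1 hσ)]

theorem mass_empty_le (t : ℕ) : mass G t ∅ ≤ (#(sinkFree G) : ℝ≥0∞)⁻¹ := by
  rw [← one_div, ENNReal.le_div_iff_mul_le (Or.inr one_ne_zero) (Or.inl (by simp)), mul_comm]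
  exact le_self_add.trans (card_sinkFree_mul_mass_add t).le

theorem cumMass_le (h0 : (sinkFree G).Nonempty) (v : V) : ∃ C : ℝ≥0∞, C ≠ ∞ ∧
    ∀ t, cumMass G t v ≤ C := by
  refine ⟨∑ σ : Orientation G with v ∈ sinks σ, (#(sinkFree G) : ℝ≥0∞)⁻¹, ?_, fun t => ?_⟩
  · rw [sum_const, nsmul_eq_mul]
    refine ENNReal.mul_ne_top (by simp) ?_
    rw [ENNReal.inv_ne_top]
    exact_mod_cast h0.card_pos.ne'
  · exact sum_le_sum fun σ _ => (mass_anti t (empty_subset _)).trans (mass_empty_le t)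

theorem tsum_sinkMass_ne_top (h0 : (sinkFree G).Nonempty) (v : V) :
    ∑' t, sinkMass G t v ≠ ∞ := by
  obtain ⟨C, hC, h⟩ := cumMass_le h0 v
  refine ne_top_of_le_ne_top hC ?_
  refine ENNReal.tsum_le_of_sum_range_le fun n => ?_
  refine le_trans ?_ (h n)
  rw [← sum_range_sinkMass]
  exact sum_le_sum_of_subset (range_mono n.le_succ)

/-- For `w ∈ T` the mass of `T` is at most that of `{w}`. Some orientation has `w` as its only sink,
so the latter is bounded by `sinkMass G t w`, a summable sequence. -/
theorem tendsto_mass_of_nonempty (hG : G.Connected) (h0 : (sinkFree G).Nonempty)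
    (hT : T.Nonempty) : Tendsto (fun t => mass G t T) atTop (𝓝 0) := by
  obtain ⟨w, hw⟩ := hT
  obtain ⟨σ, hσ⟩ := exists_onlySink hG w
  have hlim := ENNReal.tendsto_atTop_zero_of_tsum_ne_top (tsum_sinkMass_ne_top h0 w)
  refine tendsto_of_tendsto_of_tendsto_of_le_of_le tendsto_const_nhds hlim
    (fun _ => zero_le) fun t => ?_
  rw [← sinks_eq_singleton_iff] at hσ
  calc mass G t T ≤ mass G t (sinks σ) := mass_anti t (by simpa [hσ] using hw)
    _ ≤ _ := single_le_sum (f := fun σ => mass G t (sinks σ)) (fun _ _ => zero_le)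
      (by rw [mem_filter, hσ]; simp)

theorem tendsto_mass_empty (hG : G.Connected) (h0 : (sinkFree G).Nonempty) :
    Tendsto (fun t => mass G t ∅) atTop (𝓝 (#(sinkFree G) : ℝ≥0∞)⁻¹) := by
  have hc0 : (#(sinkFree G) : ℝ≥0∞) ≠ 0 := by exact_mod_cast h0.card_pos.ne'
  have h1 : Tendsto (fun t => ∑ σ : Orientation G with ¬ IsSinkFree σ, mass G t (sinks σ))
      atTop (𝓝 0) := by
    rw [← sum_const_zero (s := univ.filter fun σ : Orientation G => ¬ IsSinkFree σ)]
    refine tendsto_finsetSum _ fun σ hσ => tendsto_mass_of_nonempty hG h0 ?_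
    rw [nonempty_iff_ne_empty, Ne, sinks_eq_empty_iff]
    exact (mem_filter.1 hσ).2
  have h2 : Tendsto (fun t => (#(sinkFree G) : ℝ≥0∞)⁻¹ *
      (1 - ∑ σ : Orientation G with ¬ IsSinkFree σ, mass G t (sinks σ))) atTop
      (𝓝 ((#(sinkFree G) : ℝ≥0∞)⁻¹ * (1 - 0))) :=
    ENNReal.Tendsto.const_mul (ENNReal.Tendsto.sub tendsto_const_nhds h1 (by simp))
      (Or.inr (ENNReal.inv_ne_top.2 hc0))
  rw [tsub_zero, mul_one] at h2
  refine h2.congr fun t => ?_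
  have h3 := card_sinkFree_mul_mass_add (G := G) t
  have h4 : ∑ σ : Orientation G with ¬ IsSinkFree σ, mass G t (sinks σ) ≠ ∞ :=
    ne_top_of_le_ne_top ENNReal.one_ne_top (le_add_self.trans h3.le)
  rw [← h3, ENNReal.add_sub_cancel_right h4, ← mul_assoc, ENNReal.inv_mul_cancel hc0 (by simp),
    one_mul]

/-- The partial sums are `cumMass`; in the limit only orientations whose sinks without `v` form `∅`
contribute. -/
theorem tsum_sinkMass (hG : G.Connected) (h0 : (sinkFree G).Nonempty) (v : V) :
    ∑' t, sinkMass G t v =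
      #{σ : Orientation G | OnlySink σ v} * (#(sinkFree G) : ℝ≥0∞)⁻¹ := by
  have h1 : Tendsto (fun t => ∑ s ∈ range (t + 1), sinkMass G s v) atTop
      (𝓝 (∑' t, sinkMass G t v)) :=
    (ENNReal.summable.hasSum.tendsto_sum_nat).comp (tendsto_add_atTop_nat 1)
  refine tendsto_nhds_unique h1 ?_
  simp_rw [sum_range_sinkMass]
  have h2 : (#{σ : Orientation G | OnlySink σ v} : ℝ≥0∞) * (#(sinkFree G) : ℝ≥0∞)⁻¹ =
      ∑ σ : Orientation G with v ∈ sinks σ,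
        if OnlySink σ v then (#(sinkFree G) : ℝ≥0∞)⁻¹ else 0 := by
    rw [← sum_filter, filter_filter, sum_const, nsmul_eq_mul]
    congr 3
    ext σ
    simp only [mem_filter, mem_univ, true_and, mem_sinks]
    exact ⟨fun h => ⟨h.1, h⟩, fun h => h.2⟩
  rw [h2]
  refine tendsto_finsetSum _ fun σ hσ => ?_
  have hv := (mem_filter.1 hσ).2
  split_ifs with h
  · rw [sinks_eq_singleton_iff.2 h, erase_singleton]
    exact tendsto_mass_empty hG h0
  · refine tendsto_mass_of_nonempty hG h0 ?_
    rw [nonempty_iff_ne_empty]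
    intro he
    refine h (sinks_eq_singleton_iff.1 ?_)
    rw [← insert_erase hv, he]
    rfl

/-- Sinks are pairwise non-adjacent, so no edge is counted twice. -/
theorem card_incident_sinks (σ : Orientation G) :
    #(incident G (sinks σ)) = ∑ v ∈ sinks σ, G.degree v := by
  have h1 : incident G (sinks σ) = (sinks σ).biUnion fun v =>
      univ.filter fun e : G.edgeSet => v ∈ (e : Sym2 V) := by
    ext e
    simp
  rw [h1, card_biUnion]
  · refine sum_congr rfl fun v _ => ?_
    rw [← G.card_incidenceFinset_eq_degree, ← card_map (Function.Embedding.subtype _)]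
    congr 1
    ext e
    simp [SimpleGraph.incidenceSet, and_comm]
  · intro a ha b hb hab
    refine Finset.disjoint_left.2 fun e he he' => ?_
    simp only [mem_filter, mem_univ, true_and] at he he'
    have h3 := (Sym2.mem_and_mem_iff hab).1 ⟨he, he'⟩
    have h4 := e.2
    rw [h3] at h4
    exact (mem_sinks.1 ha).not_adj (mem_sinks.1 hb) h4

theorem drawLaw_isSink (t : ℕ) (v : V) :
    drawLaw G {ω | IsSink (run ω t) v} = sinkMass G t v := by
  rw [sinkMass, ← drawLaw_run_mem]
  simp

theorem lintegral_ncard_sinkEdges (t : ℕ) :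
    ∫⁻ ω, ((sinkEdges (run ω t)).ncard : ℝ≥0∞) ∂(drawLaw G) =
      ∑ v : V, (G.degree v : ℝ≥0∞) * sinkMass G t v := by
  have h1 : ∀ ω : Draws G, ((sinkEdges (run ω t)).ncard : ℝ≥0∞) =
      ∑ v : V, (G.degree v : ℝ≥0∞) * Set.indicator {ω | IsSink (run ω t) v} 1 ω := by
    intro ω
    rw [sinkEdges_eq_incident, Set.ncard_coe_finset, card_incident_sinks, sinks, sum_filter,
      Nat.cast_sum]
    refine sum_congr rfl fun v _ => ?_
    by_cases h : IsSink (run ω t) v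
    · simp [h]
    · simp [h]
  have hm : ∀ v : V, MeasurableSet {ω : Draws G | IsSink (run ω t) v} := fun v =>
    measurableSet_run t {σ | IsSink σ v}
  simp_rw [h1]
  rw [lintegral_finsetSum _ fun v _ => (measurable_one.indicator (hm v)).const_mul _]
  refine sum_congr rfl fun v _ => ?_
  rw [lintegral_const_mul _ (measurable_one.indicator (hm v)), lintegral_indicator_one (hm v),
    drawLaw_isSink]

theorem expectedDrawn_eq (hG : G.Connected) (h0 : (sinkFree G).Nonempty) :
    expectedDrawn G = (Nat.card G.edgeSet : ℝ≥0∞) +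
      ((∑ p ∈ soleSinks G, G.degree p.2 : ℕ) : ℝ≥0∞) * (#(sinkFree G) : ℝ≥0∞)⁻¹ := by
  have hm : ∀ t, Measurable fun ω : Draws G => ((sinkEdges (run ω t)).ncard : ℝ≥0∞) := fun t =>
    (measurable_of_finite fun σ : Orientation G => ((sinkEdges σ).ncard : ℝ≥0∞)).comp
      (measurable_run t)
  unfold expectedDrawn numDrawn
  rw [lintegral_add_left measurable_const, lintegral_const, measure_univ, mul_one,
    lintegral_tsum fun t => (hm t).aemeasurable]
  congr 1
  simp_rw [lintegral_ncard_sinkEdges]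
  rw [Summable.tsum_finsetSum fun _ _ => ENNReal.summable]
  simp_rw [ENNReal.tsum_mul_left, tsum_sinkMass hG h0, ← mul_assoc]
  rw [← sum_mul]
  congr 1
  have h1 : soleSinks G = ((univ : Finset V).sigma fun v => {σ : Orientation G | OnlySink σ v} :
      Finset (Σ _ : V, Orientation G)).map
      ((Equiv.sigmaEquivProd V _).trans (Equiv.prodComm _ _)).toEmbedding := by
    ext ⟨σ, v⟩
    simp
  rw [h1, sum_map, sum_sigma, Nat.cast_sum]
  refine sum_congr rfl fun v _ => ?_
  rw [Nat.cast_sum]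
  exact ((sum_const (G.degree v : ℝ≥0∞)).trans (by rw [nsmul_eq_mul, mul_comm])).symm

theorem measurable_output : Measurable (output : Draws G → Orientation G) := by
  have h1 : Measurable fun ω : Draws G => sInf {t | IsSinkFree (run ω t)} := by
    have hms : ∀ t, MeasurableSet {ω : Draws G | IsSinkFree (run ω t)} := fun t =>
      measurableSet_run t {σ | IsSinkFree σ}
    refine measurable_to_countable' fun k => ?_
    have : (fun ω : Draws G => sInf {t | IsSinkFree (run ω t)}) ⁻¹' {k} =
        ({ω | IsSinkFree (run ω k)} ∩ ⋂ j ∈ Set.Iio k, {ω | IsSinkFree (run ω j)}ᶜ) ∪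
          (if k = 0 then ⋂ j, {ω | IsSinkFree (run ω j)}ᶜ else ∅) := by
      ext ω
      -- The second alternative is the default `sInf ∅ = 0`, taken by runs that never halt.
      have hS : ∀ k, sInf {t | IsSinkFree (run ω t)} = k ↔
          (IsSinkFree (run ω k) ∧ ∀ j < k, ¬ IsSinkFree (run ω j)) ∨
            (k = 0 ∧ ∀ j, ¬ IsSinkFree (run ω j)) := by
        intro k
        constructor
        · rintro rfl
          by_cases hne : {t | IsSinkFree (run ω t)}.Nonempty
          · exact Or.inl ⟨Nat.sInf_mem hne, fun j hj => Nat.notMem_of_lt_sInf hj⟩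
          · rw [Set.not_nonempty_iff_eq_empty] at hne
            refine Or.inr ⟨by rw [hne, Nat.sInf_empty], fun j hj => ?_⟩
            have : j ∈ {t | IsSinkFree (run ω t)} := hj
            rw [hne] at this
            exact this
        · rintro (⟨h1, h2⟩ | ⟨rfl, h2⟩)
          · refine le_antisymm (Nat.sInf_le h1) ?_
            by_contra! hlt
            exact h2 _ hlt (Nat.sInf_mem (s := {t | IsSinkFree (run ω t)}) ⟨k, h1⟩)
          · have : {t | IsSinkFree (run ω t)} = ∅ := Set.eq_empty_iff_forall_notMem.2 h2
            rw [this, Nat.sInf_empty]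
      rw [Set.mem_preimage, Set.mem_singleton_iff, hS]
      split_ifs with h <;> simp [h]
    rw [this]
    refine MeasurableSet.union ((hms k).inter ?_) ?_
    · exact MeasurableSet.biInter (Set.to_countable _) fun j _ => (hms j).compl
    · split_ifs
      · exact MeasurableSet.iInter fun j => (hms j).compl
      · exact MeasurableSet.empty
  have h2 : Measurable fun p : Draws G × ℕ => run p.1 p.2 :=
    measurable_from_prod_countable_left fun t => measurable_run t
  exact h2.comp (measurable_id.prodMk h1)

/-- A sink-free `σ` is returned with probability at least that of `run ω t = σ` for every `t`, hence
at least `1 / F`. Domination between probability measures is equality. -/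
theorem hasLaw_output (hG : G.Connected) (h0 : (sinkFree G).Nonempty) :
    HasLaw output (uniformOn {σ : Orientation G | IsSinkFree σ}) (drawLaw G) := by
  refine ⟨measurable_output.aemeasurable, ?_⟩
  have hset : {σ : Orientation G | IsSinkFree σ} = sinkFree G := by
    ext σ
    simp
  have : IsProbabilityMeasure (uniformOn {σ : Orientation G | IsSinkFree σ}) := by
    refine isProbabilityMeasure_uniformOn (Set.toFinite _) ?_
    rw [hset]
    exact h0
  have : IsProbabilityMeasure ((drawLaw G).map output) :=
    Measure.isProbabilityMeasure_map measurable_output.aemeasurable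
  symm
  refine Measure.eq_of_le_of_measure_univ_eq ?_ (by simp)
  rw [Measure.le_iff]
  have key : ∀ σ : Orientation G, uniformOn {σ : Orientation G | IsSinkFree σ} {σ} ≤
      (drawLaw G).map output {σ} := by
    intro σ
    rw [Measure.map_apply measurable_output (measurableSet_singleton _), hset,
      ← coe_singleton, uniformOn_apply_finset]
    by_cases hσ : IsSinkFree σ
    · have h1 : sinkFree G ∩ {σ} = {σ} := by
        rw [inter_eq_right, singleton_subset_iff, mem_sinkFree]
        exact hσ
      rw [h1, card_singleton, Nat.cast_one, one_div]
      refine le_of_tendsto (tendsto_mass_empty hG h0) (Eventually.of_forall fun t => ?_)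
      rw [← sinks_eq_empty_iff.2 hσ, ← drawLaw_run]
      refine measure_mono fun ω hω => ?_
      have hω' : run ω t = σ := hω
      simp only [coe_singleton, Set.mem_preimage, Set.mem_singleton_iff]
      rw [output_eq (t := t) (hω' ▸ hσ), hω']
    · have h1 : sinkFree G ∩ {σ} = ∅ := by
        rw [inter_singleton_of_notMem]
        simpa using hσ
      simp [h1]
  intro A _
  have hA : A = ⋃ σ ∈ A.toFinset, ({σ} : Set (Orientation G)) := by
    ext σ
    simp
  rw [hA, measure_biUnion_finset, measure_biUnion_finset]
  · exact sum_le_sum fun σ _ => key σ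
  · intro σ _ σ' _ hne
    simpa using hne
  · exact fun _ _ => measurableSet_singleton _
  · intro σ _ σ' _ hne
    simpa using hne
  · exact fun _ _ => measurableSet_singleton _

theorem ae_halts (hG : G.Connected) (h0 : (sinkFree G).Nonempty) :
    ∀ᵐ ω ∂(drawLaw G), Halts ω := by
  have h1 := (hasLaw_output hG h0).measure_eq (p := IsSinkFree)
    (Set.toFinite {σ : Orientation G | IsSinkFree σ}).measurableSet
  rw [uniformOn_self (Set.toFinite _) (by simpa [Finset.Nonempty, Set.Nonempty] using h0)] at h1
  have h2 : ∀ᵐ ω ∂(drawLaw G), IsSinkFree (output ω) := by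
    refine (prob_compl_eq_zero_iff ?_).2 h1
    exact measurable_output (Set.toFinite {σ : Orientation G | IsSinkFree σ}).measurableSet
  exact h2.mono fun ω hω => ⟨_, hω⟩

end Law

end SinkPopping

namespace SinkPopping

open scoped Classical
open Finset

/-! ### The bound and a criterion for equality -/

section Bound

variable {V : Type*} [Fintype V] {G : SimpleGraph V}

/-- Existence comes from the inequality itself: its left side is positive, since an orientation with
one sink of positive degree exists. -/
theorem sinkFree_nonempty (hG : G.Connected) (hT : ¬ G.IsTree) : (sinkFree G).Nonempty := by
  have h := sum_degree_soleSinks_le_mul_card_sinkFree hG hT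
  have : Nonempty V := hG.nonempty
  obtain ⟨v⟩ := this
  obtain ⟨σ, hσ⟩ := exists_onlySink hG v
  have hnt : Nontrivial V := by
    by_contra hn
    rw [not_nontrivial_iff_subsingleton] at hn
    exact hT ⟨hG, SimpleGraph.IsAcyclic.of_subsingleton⟩
  have hpos : 0 < G.degree v := hG.preconnected.degree_pos_of_nontrivial v
  rw [← card_pos]
  by_contra h0
  have h0' : #(sinkFree G) = 0 := by omega
  rw [h0', mul_zero, Nat.le_zero, sum_eq_zero_iff] at h
  exact hpos.ne' (h (σ, v) (mem_soleSinks.2 hσ))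

theorem expectedDrawn_le (hG : G.Connected) (hT : ¬ G.IsTree) :
    expectedDrawn G ≤
      ((Nat.card G.edgeSet + Fintype.card V * (Fintype.card V - 1) : ℕ) : ℝ≥0∞) := by
  have h0 := sinkFree_nonempty hG hT
  rw [expectedDrawn_eq hG h0, Nat.cast_add]
  gcongr
  rw [← div_eq_mul_inv]
  refine ENNReal.div_le_of_le_mul ?_
  exact_mod_cast sum_degree_soleSinks_le_mul_card_sinkFree hG hT

theorem expectedDrawn_eq_of_le (hG : G.Connected) (hT : ¬ G.IsTree) {d : ℕ}
    (hd : ∀ v, (G.neighborSet v).ncard = d)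
    (hle : Fintype.card V * (Fintype.card V - 1) * #(sinkFree G) ≤ #(soleSinks G) * d) :
    expectedDrawn G =
      ((Nat.card G.edgeSet + Fintype.card V * (Fintype.card V - 1) : ℕ) : ℝ≥0∞) := by
  have h0 := sinkFree_nonempty hG hT
  have h1 : ∑ p ∈ soleSinks G, G.degree p.2 = #(soleSinks G) * d := by
    rw [← smul_eq_mul, ← sum_const]
    refine sum_congr rfl fun p _ => ?_
    rw [← hd p.2, ← Nat.card_coe_set_eq, Nat.card_eq_fintype_card, G.card_neighborSet_eq_degree]
  have h2 := le_antisymm (sum_degree_soleSinks_le_mul_card_sinkFree hG hT) (h1 ▸ hle)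
  rw [expectedDrawn_eq hG h0, h2, Nat.cast_add, Nat.cast_mul _ (#(sinkFree _)), mul_assoc,
    ENNReal.mul_inv_cancel _ (by simp), mul_one]
  exact_mod_cast h0.card_pos.ne'

end Bound

/-! ### Equality on cycles -/

section Cycle

open SimpleGraph

variable {k : ℕ} {τ : Orientation (cycleGraph (k + 3))} {i v w : Fin (k + 3)}

theorem cycleGraph_adj_add_one (i : Fin (k + 3)) : (cycleGraph (k + 3)).Adj i (i + 1) := by
  rw [cycleGraph_adj]
  right
  abel

theorem cycleGraph_adj_cases {i j : Fin (k + 3)} (h : (cycleGraph (k + 3)).Adj i j) :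
    j = i + 1 ∨ i = j + 1 := by
  rw [cycleGraph_adj] at h
  rcases h with h | h
  · exact Or.inr (by rw [← h]; abel)
  · exact Or.inl (by rw [← h]; abel)

theorem cycleGraph_not_isTree : ¬ (cycleGraph (k + 3)).IsTree := by
  intro h
  have h1 := (isTree_iff_connected_and_card.1 h).2
  have h2 := (cycleGraph (k + 3)).sum_degrees_eq_twice_card_edges
  simp_rw [cycleGraph_degree_three_le] at h2
  rw [sum_const, card_univ, Fintype.card_fin, smul_eq_mul, edgeFinset_card] at h2
  rw [Nat.card_eq_fintype_card, Nat.card_eq_fintype_card, Fintype.card_fin] at h1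
  omega

theorem isSink_cycleGraph_iff :
    IsSink τ (v + 1) ↔ ¬ Arc τ (v + 1) (v + 1 + 1) ∧ Arc τ v (v + 1) := by
  rw [isSink_iff_forall_not_arc]
  constructor
  · exact fun h => ⟨h _, (arc_or_arc (cycleGraph_adj_add_one v)).resolve_right (h _)⟩
  · rintro ⟨h1, h2⟩ u hu
    rcases cycleGraph_adj_cases hu.adj with rfl | h
    · exact h1 hu
    · obtain rfl := add_right_cancel h
      exact h2.asymm hu

open Fin.NatCast Fin.CommRing in
-- If `i → i + 1` but not `i + 1 → i + 2`, then `i + 1` is a sink; so one forward arc makes the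
-- whole cycle run forward.
theorem arc_propagate (hτ : IsSinkFree τ) (hi : Arc τ i (i + 1)) (j : Fin (k + 3)) :
    Arc τ j (j + 1) := by
  have key : ∀ m : ℕ, Arc τ (i + (m : Fin (k + 3))) (i + (m : Fin (k + 3)) + 1) := by
    intro m
    induction m with
    | zero => simpa using hi
    | succ m ih =>
      have h := hτ (i + (m : Fin (k + 3)) + 1)
      rw [isSink_cycleGraph_iff] at h
      by_contra hn
      refine h ⟨fun h' => hn ?_, ih⟩
      rwa [Nat.cast_succ, ← add_assoc]
  have := key (j - i).val
  rwa [Fin.cast_val_eq_self, add_sub_cancel] at this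

theorem card_sinkFree_cycleGraph_le : #(sinkFree (cycleGraph (k + 3))) ≤ 2 := by
  have h : #(univ : Finset Prop) = 2 := by simp
  rw [← h]
  refine card_le_card_of_injOn (fun τ => Arc τ 0 (0 + 1)) (fun _ _ => mem_coe.2 (mem_univ _)) ?_
  intro σ hσ τ hτ hστ
  rw [mem_coe, mem_sinkFree] at hσ hτ
  have key : ∀ i, Arc σ i (i + 1) ↔ Arc τ i (i + 1) := fun i =>
    ⟨fun h => arc_propagate hτ (hστ.mp (arc_propagate hσ h 0)) i,
      fun h => arc_propagate hσ (hστ.mpr (arc_propagate hτ h 0)) i⟩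
  refine orientation_ext fun a b hab => ?_
  rcases cycleGraph_adj_cases hab.adj with rfl | rfl
  · exact (key a).1 hab
  · exact (arc_or_arc (cycleGraph_adj_add_one b)).resolve_left
      fun h => hab.asymm ((key b).2 h)

theorem exists_orientation_cycleGraph (b : Fin (k + 3) → Prop) :
    ∃ τ : Orientation (cycleGraph (k + 3)), ∀ i, Arc τ i (i + 1) ↔ b i := by
  have hne : ∀ i : Fin (k + 3), i + 1 ≠ i := fun i => (cycleGraph_adj_add_one i).ne'
  -- The length being at least three is what makes the edges `s(i, i + 1)` distinct.
  have h2 : ∀ i : Fin (k + 3), i + 1 + 1 ≠ i := by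
    intro i h
    rw [add_assoc, add_eq_left] at h
    have := congrArg Fin.val h
    rw [Fin.val_add, Fin.val_one, Fin.val_zero, Nat.mod_eq_of_lt (by omega)] at this
    omega
  have huniq : ∀ i j : Fin (k + 3), s(i, i + 1) = s(j, j + 1) → i = j := by
    intro i j h
    rcases Sym2.eq_iff.1 h with h | ⟨h, h'⟩
    · exact h.1
    · rw [h] at h'
      exact absurd h' (h2 j)
  have hex : ∀ e : (cycleGraph (k + 3)).edgeSet, ∃ h : Head _ e,
      ∀ i, (e : Sym2 (Fin (k + 3))) = s(i, i + 1) → (h.1 = i + 1 ↔ b i) := by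
    rintro ⟨e, he⟩
    obtain ⟨j, rfl⟩ : ∃ j, e = s(j, j + 1) := by
      induction e with
      | h x y =>
        have he' : (cycleGraph (k + 3)).Adj x y := he
        rcases cycleGraph_adj_cases he' with rfl | rfl
        · exact ⟨x, rfl⟩
        · exact ⟨y, Sym2.eq_swap⟩
    by_cases hb : b j
    · refine ⟨⟨j + 1, Sym2.mem_mk_right _ _⟩, fun i hi => ?_⟩
      obtain rfl := huniq _ _ hi
      simp [hb]
    · refine ⟨⟨j, Sym2.mem_mk_left _ _⟩, fun i hi => ?_⟩
      obtain rfl := huniq _ _ hi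
      simp [hb]
  choose τ hτ using hex
  refine ⟨τ, fun i => ⟨?_, fun hi => ?_⟩⟩
  · rintro ⟨e, he, h⟩
    exact (hτ e i he).1 h
  · exact ⟨⟨s(i, i + 1), (mem_edgeSet _).2 (cycleGraph_adj_add_one i)⟩, rfl,
      (hτ _ i rfl).2 hi⟩

theorem val_sub_of_ne (h : i + 1 ≠ w) : (i + 1 - w).val = (i - w).val + 1 := by
  have h1 : i + 1 - w ≠ 0 := sub_ne_zero.2 h
  have h2 := Fin.val_sub_one_of_ne_zero h1
  have h3 : i + 1 - w - 1 = i - w := by abel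
  rw [h3] at h2
  have h4 : (i + 1 - w).val ≠ 0 := fun h => h1 (Fin.ext h)
  omega

theorem card_soleSinks_cycleGraph :
    (k + 3) * (k + 2) ≤ #(soleSinks (cycleGraph (k + 3))) := by
  have hcard : #(univ : Finset (Fin (k + 3))).offDiag = (k + 3) * (k + 2) := by
    rw [offDiag_card, card_univ, Fintype.card_fin, ← Nat.mul_sub_one]
    rfl
  choose! τ hτ using exists_orientation_cycleGraph (k := k)
  -- A pair `(v, w)` encodes the orientation with sink `v` and source `w`: edges run forward from
  -- `w` up to `v` and backward on the rest.
  let b : Fin (k + 3) × Fin (k + 3) → Fin (k + 3) → Prop :=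
    fun p i => (i - p.2).val < (p.1 - p.2).val
  have hD : ∀ p : Fin (k + 3) × Fin (k + 3), p.1 ≠ p.2 → b p p.2 := by
    intro p hp
    have h1 : p.1 - p.2 ≠ 0 := sub_ne_zero.2 hp
    have h2 : (p.1 - p.2).val ≠ 0 := fun h => h1 (Fin.ext h)
    simp only [b, sub_self, Fin.val_zero]
    omega
  have hlast : ∀ (p : Fin (k + 3) × Fin (k + 3)) (i : Fin (k + 3)), i + 1 = p.2 → ¬ b p i := by
    intro p i hi
    have h1 : i - p.2 = -1 := by rw [← hi]; abel
    have h2 := (p.1 - p.2).isLt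
    simp only [b, h1, Fin.coe_neg_one]
    omega
  rw [← hcard]
  refine card_le_card_of_injOn (fun p => (τ (b p), p.1)) ?_ ?_
  · intro p hp
    have hp' : p.1 ≠ p.2 := (mem_offDiag.1 hp).2.2
    rw [mem_coe, mem_soleSinks]
    have hs : ∀ x, IsSink (τ (b p)) x ↔ x = p.1 := by
      intro x
      obtain ⟨i, rfl⟩ : ∃ i, x = i + 1 := ⟨x - 1, by abel⟩
      rw [isSink_cycleGraph_iff, hτ, hτ]
      by_cases hi : i + 1 = p.2
      · rw [hi]
        exact ⟨fun h => absurd (hD p hp') h.1, fun h => absurd h.symm hp'⟩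
      · have h1 := val_sub_of_ne hi
        simp only [b]
        constructor
        · intro h
          have h2 : i + 1 - p.2 = p.1 - p.2 := Fin.ext (by omega)
          exact sub_left_injective h2
        · rintro h
          rw [h] at h1
          rw [h]
          omega
    exact ⟨(hs _).2 rfl, fun w hw => (hs w).1 hw⟩
  · rintro ⟨v, w⟩ hp ⟨v', w'⟩ hq h
    obtain ⟨h1, h2⟩ := Prod.mk.inj h
    dsimp only at h2
    subst h2
    have hb : ∀ i, b (v, w) i ↔ b (v, w') i := fun i => by
      rw [← hτ (b (v, w)) i, ← hτ (b (v, w')) i, h1]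
    have hvw : v ≠ w := (mem_offDiag.1 hp).2.2
    -- The source is recovered as well: the edge after `w` is forward and the edge before it
    -- backward, whereas measured from another `w'` a forward edge after `w` makes the edge before
    -- it forward too.
    by_contra hne
    have hww : w ≠ w' := fun h => hne (by rw [h])
    obtain ⟨i, hi⟩ : ∃ i, i + 1 = w := ⟨w - 1, by abel⟩
    have h3 := (hb w).1 (hD (v, w) hvw)
    refine hlast (v, w) i hi ((hb i).2 ?_)
    have h4 := val_sub_of_ne (i := i) (w := w') (by rwa [hi])
    rw [hi] at h4
    simp only [b] at h3 ⊢
    omega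

theorem expectedDrawn_cycleGraph (k : ℕ) : expectedDrawn (cycleGraph (k + 3)) =
    ((Nat.card (cycleGraph (k + 3)).edgeSet + (k + 3) * (k + 2) : ℕ) : ℝ≥0∞) := by
  have hG : (cycleGraph (k + 3)).Connected := cycleGraph_connected
  have hT : ¬ (cycleGraph (k + 3)).IsTree := cycleGraph_not_isTree
  have hd : ∀ v, ((cycleGraph (k + 3)).neighborSet v).ncard = 2 := by
    intro v
    rw [← Nat.card_coe_set_eq, Nat.card_eq_fintype_card, card_neighborSet_eq_degree,
      cycleGraph_degree_three_le]
  rw [expectedDrawn_eq_of_le hG hT hd, Fintype.card_fin]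
  · rfl
  · rw [Fintype.card_fin]
    exact Nat.mul_le_mul card_soleSinks_cycleGraph card_sinkFree_cycleGraph_le

end Cycle

end SinkPopping

theorem theorem5p4 :
    (∀ {V : Type*} [Finite V] (G : SimpleGraph V), G.Connected → ¬ G.IsTree →
      (∀ᵐ ω ∂(SinkPopping.drawLaw G), SinkPopping.Halts ω) ∧
      HasLaw SinkPopping.output
        (uniformOn {σ : SinkPopping.Orientation G | SinkPopping.IsSinkFree σ})
        (SinkPopping.drawLaw G) ∧
      SinkPopping.expectedDrawn G ≤
        ((Nat.card G.edgeSet + Nat.card V * (Nat.card V - 1) : ℕ) : ℝ≥0∞)) ∧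
    (∀ n : ℕ, 3 ≤ n →
      SinkPopping.expectedDrawn (SimpleGraph.cycleGraph n) =
        ((Nat.card (SimpleGraph.cycleGraph n).edgeSet + n * (n - 1) : ℕ) : ℝ≥0∞)) := by
  constructor
  · intro V _ G hG hT
    have := Fintype.ofFinite V
    have h0 := SinkPopping.sinkFree_nonempty hG hT
    refine ⟨SinkPopping.ae_halts hG h0, SinkPopping.hasLaw_output hG h0, ?_⟩
    rw [Nat.card_eq_fintype_card (α := V)]
    exact SinkPopping.expectedDrawn_le hG hT
  · intro n hn
    obtain ⟨k, rfl⟩ := Nat.exists_eq_add_of_le' hn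
    exact SinkPopping.expectedDrawn_cycleGraph k
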